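/- For a Borel measure $\mu$ on $\mathbb R^n$ put $$\Gamma(\mu)=\sup_{Q}\ \liminf_{\varepsilon\to 0+}\frac{\mu\big((Q+\varepsilon B_2^n)\setminus Q\big)}{\varepsilon},$$ where $Q$ runs over all convex subsets of $\mathbb R^n$ and $B_2^n$ is the closed Euclidean unit ball. The measure $\mu$ is log-concave if $\mu(\lambda A+(1-\lambda)B)\ge\mu(A)^{\lambda}\mu(B)^{1-\lambda}$ for all Borel sets $A,B$ and all $\lambda\in(0,1)$, and a probability measure $\mu$ is isotropic if it has barycenter $0$ and $\int\langle x,\theta\rangle^2\,d\mu(x)=1$ for every unit vector $\theta$. A log-concave density of $\mu$ is a density of $\mu$ of the form $f=e^{-\varphi}$ with $\varphi:\mathbb R^n\to(-\infty,\infty]$ convex. For such $f$ and $t>0$, let $K_t(f)=\{x: f(x)\ge t\}$; $|\cdot|$ is Lebesgue measure and $\|f\|_\infty$ is the $L^\infty$ norm. There are absolute constants $C_1,C_2,C>0$ such that the following holds for every $n\ge 1$. Let $\mu$ be an isotropic log-concave probability measure on $\mathbb R^n$ which satisfies at least one of the conditions (a) $\mu$ is the uniform probability measure on a convex set; (b)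 $\mu$ has homogeneous level sets: for some log-concave density $f$ of $\mu$ and some set $K$, each level set $K_t(f)$ with $0<t<\|f\|_\infty$ is of the form $y+rK$ with $r>0$ and $y\in\mathbb R^n$; (c) $\mu$ is 1-symmetric: invariant under all permutations and all sign changes of the coordinates. Then $\mu$ has a log-concave density, and for every log-concave density $f$ of $\mu$ there are $t>0$ and $y\in\mathbb R^n$ with $$|K_t(f)|\le\frac{C_1}{\|f\|_\infty}\qquad\text{and}\qquad y+C_2B_2^n\subset K_t(f).$$ Moreover $\Gamma(\mu)\le Cn$. In particular, (b) covers measures with a density of the form $c\,e^{-\|x\|}$: every measure on $\mathbb R^n$, $n\ge1$, that has such a density, with $c>0$ and $\|\cdot\|$ a norm on $\mathbb R^n$, has homogeneous level sets. The bound on $\Gamma$ is sharp in order in all three classes: there is an absolute constant $c>0$ such that for every $n\ge 1$ some isotropic log-concave probability measure $\mu$ on $\mathbb R^n$ satisfies (a), (b) and (c) together and has $\Gamma(\mu)\ge cn$. -/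

import Mathlib

open MeasureTheory Filter Topology
open scoped ENNReal Pointwise

/-- Outer perimeter of `Q` with respect to `μ`: the lower limit, as `ε → 0+`, of
`μ ((Q + ε B) \ Q) / ε`, where `B` is the closed Euclidean unit ball. -/
noncomputable def perimeter {n : ℕ} (μ : Measure (EuclideanSpace ℝ (Fin n)))
    (Q : Set (EuclideanSpace ℝ (Fin n))) : ℝ≥0∞ :=
  liminf (fun ε : ℝ => μ ((Q + ε • Metric.closedBall 0 1) \ Q) / ENNReal.ofReal ε) (𝓝[>] 0)

/-- The maximal perimeter `Γ(μ)` over all convex sets. -/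
noncomputable def maxPerimeter {n : ℕ} (μ : Measure (EuclideanSpace ℝ (Fin n))) : ℝ≥0∞ :=
  ⨆ (Q : Set (EuclideanSpace ℝ (Fin n))) (_ : Convex ℝ Q), perimeter μ Q

/-- Log-concave measures. For `l = 0` and `l = 1` the inequality is trivial for nonempty sets (and
meaningless for empty ones, because of the convention `0 ^ 0 = 1`). -/
def IsLogConcaveMeasure {n : ℕ} (μ : Measure (EuclideanSpace ℝ (Fin n))) : Prop :=
  ∀ A B : Set (EuclideanSpace ℝ (Fin n)), MeasurableSet A → MeasurableSet B →
    ∀ l : ℝ, 0 < l → l < 1 → μ A ^ l * μ B ^ (1 - l) ≤ μ (l • A + (1 - l) • B)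

/-- Isotropic probability measures: barycenter at the origin and identity covariance. The
nonzero value `1` of the second moments forces all the integrands to be integrable. -/
structure IsIsotropicMeasure {n : ℕ} (μ : Measure (EuclideanSpace ℝ (Fin n))) : Prop where
  isProbabilityMeasure : IsProbabilityMeasure μ
  barycenter_eq_zero : ∫ x, x ∂μ = 0
  second_moment : ∀ θ : EuclideanSpace ℝ (Fin n), ‖θ‖ = 1 → ∫ x, (inner ℝ x θ) ^ 2 ∂μ = 1

/-- `f` is a density of `μ` of the form `exp (-φ)` with `φ` convex and valued in `(-∞, ∞]`, that
is, a nonnegative log-concave density. (Such an `f` is automatically Lebesgue measurable.) -/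
structure IsLogConcaveDensity {n : ℕ} (f : EuclideanSpace ℝ (Fin n) → ℝ)
    (μ : Measure (EuclideanSpace ℝ (Fin n))) : Prop where
  nonneg : ∀ x, 0 ≤ f x
  logConcave : ∀ x y : EuclideanSpace ℝ (Fin n), ∀ l : ℝ, 0 ≤ l → l ≤ 1 →
    f x ^ l * f y ^ (1 - l) ≤ f (l • x + (1 - l) • y)
  eq_withDensity : μ = volume.withDensity (fun x => ENNReal.ofReal (f x))

/-- The level set `K_t(f)`. -/
def levelSet {n : ℕ} (f : EuclideanSpace ℝ (Fin n) → ℝ) (t : ℝ) :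
    Set (EuclideanSpace ℝ (Fin n)) :=
  {x | t ≤ f x}

/-- `μ` is the uniform probability measure on a convex set. -/
def IsUniformOnConvex {n : ℕ} (μ : Measure (EuclideanSpace ℝ (Fin n))) : Prop :=
  ∃ K : Set (EuclideanSpace ℝ (Fin n)), Convex ℝ K ∧ volume K ≠ 0 ∧ volume K ≠ ∞ ∧
    μ = (volume K)⁻¹ • volume.restrict K

/-- `μ` has homogeneous level sets: it has a log-concave density `f` all of whose level sets
`K_t(f)`, `0 < t < ‖f‖_∞`, are positive dilates, up to translation, of one and the same set. -/
def HasHomogeneousLevelSets {n : ℕ} (μ : Measure (EuclideanSpace ℝ (Fin n))) : Prop :=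
  ∃ f : EuclideanSpace ℝ (Fin n) → ℝ, IsLogConcaveDensity f μ ∧
    ∃ K : Set (EuclideanSpace ℝ (Fin n)),
      ∀ t : ℝ, 0 < t → ENNReal.ofReal t < eLpNorm f ∞ volume →
        ∃ r : ℝ, 0 < r ∧ ∃ y : EuclideanSpace ℝ (Fin n), levelSet f t = {y} + r • K

/-- `μ` has a density of the form `c * exp (-p x)` with `p` a norm. -/
def HasExpNormDensity {n : ℕ} (μ : Measure (EuclideanSpace ℝ (Fin n))) : Prop :=
  ∃ (p : Seminorm ℝ (EuclideanSpace ℝ (Fin n))) (c : ℝ), (∀ x, p x = 0 → x = 0) ∧ 0 < c ∧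
    μ = volume.withDensity (fun x => ENNReal.ofReal (c * Real.exp (-p x)))

/-- `μ` is 1-symmetric: invariant under the symmetries of the cube, that is, under all
permutations and sign changes of the coordinates. -/
def IsOneSymmetric {n : ℕ} (μ : Measure (EuclideanSpace ℝ (Fin n))) : Prop :=
  ∀ (σ : Equiv.Perm (Fin n)) (s : Fin n → ℤˣ),
    μ.map (fun x : EuclideanSpace ℝ (Fin n) =>
      WithLp.toLp 2 (fun i => ((s i : ℤ) : ℝ) * x (σ i))) = μ

/-!
Suppose that `K_t(f)` contains a ball of radius `ρ`. For `s ≤ t` and convex `Q`, the part of the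
`ε`-shell of `Q` in `K_s(f)` is no larger than the `ε`-shell of `K_s(f)` itself, which lies in a
homothetic copy of `K_s(f)` of ratio `1 + ε / ρ`. The levels above `t` are dominated by `t`, and
integration over all levels gives `Γ(μ) ≤ (n / ρ) * (1 + ‖f‖_∞ * |K_t(f)|)`. It remains to find a
level set of volume `O(1 / ‖f‖_∞)` that contains a ball of constant radius.

Borell's tail estimate and the Paley–Zygmund inequality bound from below the mass of half-spaces
near the barycenter, so every convex set of almost full measure contains a ball of constant radius.
The level set at height `c ^ n * ‖f‖_∞` has almost full measure, and its volume is at most `C ^ n`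
times that of some level set of volume at most `2 / ‖f‖_∞`. If the level sets are homogeneous, as
they trivially are for uniform measures, then the two are dilates of each other of ratio at most
`C`. If `μ` is 1-symmetric, then a symmetric convex set contains with each point `x` the cube of
half-width `(∑ i, |x i|) / n`, and the points with `(∑ i, |x i|) / n ≤ a` have volume at most
`(2 e a) ^ n`, so that large volume forces a large inscribed cube.

The density itself is the lower density of `μ`, to which log-concavity passes from balls. Were it
infinite somewhere, `μ` would live on the null convex set where it is infinite, against isotropy.
Sharpness is seen on the cube, by slightly shrunk concentric cubes and the prisms over their facets.
-/

/-! ### Shells of convex sets -/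

section OuterShell

/-- The outer `ε`-shell `(Q + ε B) \ Q` of `Q`, whose measure is the numerator in `perimeter`. -/
def outerShell {E : Type*} [NormedAddCommGroup E] [NormedSpace ℝ E] (Q : Set E) (ε : ℝ) :
    Set E :=
  (Q + ε • Metric.closedBall 0 1) \ Q

/-- The `k`-th of the layers of thickness `ε` into which the complement of the closure of `Q` is
cut by the distance to `Q`. -/
def distLayer {E : Type*} [PseudoMetricSpace E] (Q : Set E) (ε : ℝ) (k : ℕ) : Set E :=
  {x | Metric.infDist x Q ∈ Set.Ioc (k * ε) ((k + 1) * ε)}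

theorem measurableSet_distLayer {E : Type*} [PseudoMetricSpace E] [MeasurableSpace E]
    [OpensMeasurableSpace E] (Q : Set E) (ε : ℝ) (k : ℕ) : MeasurableSet (distLayer Q ε k) :=
  (Metric.continuous_infDist_pt Q).measurable measurableSet_Ioc

theorem pairwise_disjoint_distLayer {E : Type*} [PseudoMetricSpace E] (Q : Set E) (ε : ℝ) :
    Pairwise (Function.onFun Disjoint (distLayer Q ε)) := by
  intro i j hij
  have hIoc := Set.pairwise_disjoint_Ioc_add_zsmul 0 ε (Nat.cast_injective.ne hij)
  simp only [Function.onFun, zero_add, zsmul_eq_mul, Int.cast_add, Int.cast_natCast,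
    Int.cast_one] at hIoc
  exact hIoc.preimage fun x => Metric.infDist x Q

theorem tsum_measure_inter_distLayer_le {E : Type*} [PseudoMetricSpace E]
    [MeasurableSpace E] [OpensMeasurableSpace E] (μ : Measure E) (Q : Set E) (ε : ℝ) {A : Set E}
    (hA : NullMeasurableSet A μ) :
    ∑' k, μ (A ∩ distLayer Q ε k) ≤ μ A := by
  rw [← measure_iUnion₀ (fun i j hij => ((pairwise_disjoint_distLayer Q ε hij).mono
      Set.inter_subset_right Set.inter_subset_right).aedisjoint)
    fun k => hA.inter (measurableSet_distLayer Q ε k).nullMeasurableSet]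
  exact measure_mono (Set.iUnion_subset fun k => Set.inter_subset_left)

theorem mem_add_smul_closedBall_iff {E : Type*} [NormedAddCommGroup E] [NormedSpace ℝ E]
    {Q : Set E} {ε : ℝ} (hε : 0 ≤ ε) {x : E} :
    x ∈ Q + ε • Metric.closedBall (0 : E) 1 ↔ ∃ q ∈ Q, dist x q ≤ ε := by
  simp only [smul_unitClosedBall_of_nonneg hε, Set.mem_add, mem_closedBall_zero_iff]
  constructor
  · rintro ⟨q, hq, v, hv, rfl⟩
    exact ⟨q, hq, by simpa [dist_eq_norm] using hv⟩
  · rintro ⟨q, hq, hx⟩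
    exact ⟨q, hq, x - q, by rwa [← dist_eq_norm], add_sub_cancel q x⟩

theorem subset_add_smul_closedBall {E : Type*} [NormedAddCommGroup E] [NormedSpace ℝ E]
    {Q : Set E} {ε : ℝ} (hε : 0 ≤ ε) : Q ⊆ Q + ε • Metric.closedBall (0 : E) 1 := fun x hx =>
  (mem_add_smul_closedBall_iff hε).2 ⟨x, hx, by rwa [dist_self]⟩

theorem add_smul_closedBall_subset_image_homothety {E : Type*} [NormedAddCommGroup E]
    [NormedSpace ℝ E] {L : Set E} (hL : Convex ℝ L) {y : E} {ρ : ℝ} (hρ : 0 < ρ)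
    (hball : Metric.closedBall y ρ ⊆ L) {ε : ℝ} (hε : 0 < ε) :
    L + ε • Metric.closedBall (0 : E) 1 ⊆ AffineMap.homothety y (1 + ε / ρ) '' L := by
  rintro _ ⟨x, hx, _, ⟨v, hv, rfl⟩, rfl⟩
  have hs : 0 < 1 + ε / ρ := by positivity
  have hy : y + ρ • v ∈ L := hball <| by
    rw [mem_closedBall_zero_iff] at hv
    rw [Metric.mem_closedBall, dist_self_add_left, norm_smul, Real.norm_of_nonneg hρ.le]
    exact mul_le_of_le_one_right hρ.le hv
  refine ⟨(1 + ε / ρ)⁻¹ • x + (1 - (1 + ε / ρ)⁻¹) • (y + ρ • v),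
    hL hx hy (by positivity) (sub_nonneg.2 (inv_le_one_of_one_le₀ ?_)) (by ring), ?_⟩
  · exact le_add_of_nonneg_right (by positivity)
  · rw [AffineMap.homothety_apply, vsub_eq_sub, vadd_eq_add]
    match_scalars <;> field_simp <;> ring

theorem outerShell_inter_subset {E : Type*} [NormedAddCommGroup E] [NormedSpace ℝ E]
    {Q L : Set E} {ε : ℝ} (hε : 0 ≤ ε) :
    outerShell Q ε ∩ L ⊆ (L ∩ distLayer Q ε 0) ∪ frontier Q := by
  rintro x ⟨⟨hx, hxQ⟩, hxL⟩
  obtain ⟨q, hq, hxq⟩ := (mem_add_smul_closedBall_iff hε).1 hx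
  by_cases hcl : x ∈ closure Q
  · exact .inr ⟨hcl, fun hint => hxQ (interior_subset hint)⟩
  · refine .inl ⟨hxL, ?_, ?_⟩
    · rw [Nat.cast_zero, zero_mul, ← Metric.infDist_closure]
      exact (isClosed_closure.notMem_iff_infDist_pos ⟨q, subset_closure hq⟩).1 hcl
    · rw [Nat.cast_zero, zero_add, one_mul]
      exact (Metric.infDist_le_dist_of_mem hq).trans hxq

section ExpandingMap

variable {E : Type*} [NormedAddCommGroup E] [InnerProductSpace ℝ E]

theorem exists_unit_subgradient_infDist [CompleteSpace E] {Q : Set E} (hQ : Convex ℝ Q)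
    (hne : Q.Nonempty) (x : E) :
    ∃ v : E, (0 < Metric.infDist x Q → ‖v‖ = 1) ∧ ‖v‖ ≤ 1 ∧
      ∀ z, Metric.infDist x Q + inner ℝ v (z - x) ≤ Metric.infDist z Q := by
  rcases (Metric.infDist_nonneg (x := x) (s := Q)).eq_or_lt with hx | hx
  · exact ⟨0, fun h => absurd hx h.ne, by simp, fun z => by simp [← hx, Metric.infDist_nonneg]⟩
  have exists_nearest (z : E) : ∃ p ∈ closure Q, Metric.infDist z Q = ‖z - p‖ ∧
      ∀ w ∈ closure Q, inner ℝ (z - p) (w - p) ≤ 0 := by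
    obtain ⟨p, hp, hmin⟩ := exists_norm_eq_iInf_of_complete_convex hne.closure
      isClosed_closure.isComplete hQ.closure z
    refine ⟨p, hp, ?_, (norm_eq_iInf_iff_real_inner_le_zero hQ.closure hp).1 hmin⟩
    rw [hmin, ← Metric.infDist_closure, Metric.infDist_eq_iInf]
    simp only [dist_eq_norm]
  obtain ⟨p, -, hd, hp⟩ := exists_nearest x
  rw [hd] at hx ⊢
  have hunit : ‖‖x - p‖⁻¹ • (x - p)‖ = 1 := by
    rw [norm_smul, norm_inv, norm_norm, inv_mul_cancel₀ hx.ne']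
  refine ⟨‖x - p‖⁻¹ • (x - p), fun _ => hunit, hunit.le, fun z => ?_⟩
  obtain ⟨q, hq, hdz, -⟩ := exists_nearest z
  have hsplit : inner ℝ (x - p) (z - x) =
      inner ℝ (x - p) (z - q) + inner ℝ (x - p) (q - p) - ‖x - p‖ * ‖x - p‖ := by
    rw [← real_inner_self_eq_norm_mul_norm, ← inner_add_right, ← inner_sub_right]
    congr 1
    abel
  have hcs : inner ℝ (x - p) (z - q) ≤ ‖x - p‖ * ‖z - q‖ := real_inner_le_norm _ _
  rw [real_inner_smul_left, ← le_sub_iff_add_le', inv_mul_le_iff₀ hx, hdz, hsplit]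
  linarith [hp q hq]

theorem dist_le_dist_add_smul {x y u v : E} (h : 0 ≤ inner ℝ (x - y) (u - v)) {ε : ℝ}
    (hε : 0 ≤ ε) : dist x y ≤ dist (x + ε • u) (y + ε • v) := by
  have hdiff : x + ε • u - (y + ε • v) = (x - y) + ε • (u - v) := by module
  rw [dist_eq_norm, dist_eq_norm, hdiff]
  refine le_of_sq_le_sq ?_ (norm_nonneg _)
  rw [norm_add_sq_real, real_inner_smul_right]
  nlinarith [sq_nonneg ‖ε • (u - v)‖, mul_nonneg hε h]

/-- Moving along the outer normals, i.e. the gradient of the distance to `Q`, is expanding because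
the gradient of a convex function is monotone. -/
theorem exists_expanding_map_infDist_add [CompleteSpace E] {Q : Set E} (hQ : Convex ℝ Q)
    (hne : Q.Nonempty) {ε : ℝ} (hε : 0 ≤ ε) :
    ∃ T : E → E, AntilipschitzWith 1 T ∧ (∀ x, dist (T x) x ≤ ε) ∧
      ∀ x, 0 < Metric.infDist x Q → Metric.infDist (T x) Q = Metric.infDist x Q + ε := by
  choose N hunit hle hsub using exists_unit_subgradient_infDist hQ hne
  have hdist (x : E) : dist (x + ε • N x) x ≤ ε := by
    rw [dist_self_add_left, norm_smul, Real.norm_of_nonneg hε]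
    exact mul_le_of_le_one_right hε (hle x)
  refine ⟨fun x => x + ε • N x, .of_le_mul_dist fun x y => ?_, hdist, fun x hx => ?_⟩
  · have hmono : 0 ≤ inner ℝ (x - y) (N x - N y) := by
      have hswap : inner ℝ (x - y) (N x - N y) =
          -inner ℝ (N x) (y - x) - inner ℝ (N y) (x - y) := by
        rw [real_inner_comm, inner_sub_left, ← inner_neg_right, neg_sub]
      linarith [hsub x y, hsub y x]
    simpa using dist_le_dist_add_smul hmono hε
  · refine le_antisymm ?_ ?_
    · linarith [Metric.infDist_le_infDist_add_dist (s := Q) (x := x + ε • N x) (y := x), hdist x]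
    · simpa [real_inner_smul_right, real_inner_self_eq_norm_mul_norm, hunit x hx] using
        hsub x (x + ε • N x)

end ExpandingMap

section HaarMeasure

variable {E : Type*} [NormedAddCommGroup E] [NormedSpace ℝ E] [FiniteDimensional ℝ E]
  [MeasurableSpace E] [BorelSpace E] (μ : Measure E) [μ.IsAddHaarMeasure] {L : Set E}

theorem addHaar_le_mul_addHaar_image_of_antilipschitzWith {K : NNReal} {T : E → E}
    (hT : AntilipschitzWith K T) (A : Set E) :
    μ A ≤ (K : ℝ≥0∞) ^ (Module.finrank ℝ E : ℝ) * μ (T '' A) := by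
  have : (μH[Module.finrank ℝ E] : Measure E).IsAddHaarMeasure := isAddHaarMeasure_hausdorffMeasure
  rw [Measure.isAddLeftInvariant_eq_smul μ μH[Module.finrank ℝ E]]
  simp only [Measure.smul_apply, ENNReal.smul_def, smul_eq_mul]
  rw [mul_left_comm]
  gcongr
  exact hT.le_hausdorffMeasure_image (Nat.cast_nonneg _) A

theorem addHaar_outerShell_le (hL : Convex ℝ L) (hLfin : μ L ≠ ∞) {y : E} {ρ : ℝ} (hρ : 0 < ρ)
    (hball : Metric.closedBall y ρ ⊆ L) {ε : ℝ} (hε : 0 < ε) :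
    μ (outerShell L ε) ≤ ENNReal.ofReal ((1 + ε / ρ) ^ Module.finrank ℝ E - 1) * μ L := by
  rw [outerShell, measure_sdiff (subset_add_smul_closedBall hε.le) (hL.nullMeasurableSet μ) hLfin,
    ENNReal.ofReal_sub _ zero_le_one, ENNReal.ofReal_one, ENNReal.sub_mul (fun _ _ => hLfin),
    one_mul]
  refine tsub_le_tsub_right ?_ _
  calc μ (L + ε • Metric.closedBall (0 : E) 1)
      ≤ μ (AffineMap.homothety y (1 + ε / ρ) '' L) :=
        measure_mono (add_smul_closedBall_subset_image_homothety hL hρ hball hε)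
    _ = ENNReal.ofReal ((1 + ε / ρ) ^ Module.finrank ℝ E) * μ L := by
        rw [Measure.addHaar_image_homothety, abs_of_nonneg (by positivity)]

end HaarMeasure

theorem le_tsum_of_le_succ_add {a b : ℕ → ℝ≥0∞} (hstep : ∀ k, a k ≤ a (k + 1) + b k)
    (ha : Tendsto a atTop (𝓝 0)) : a 0 ≤ ∑' k, b k := by
  have hpartial (m : ℕ) : a 0 ≤ a m + ∑ k ∈ Finset.range m, b k := by
    induction m with
    | zero => simp
    | succ m ih =>
      rw [Finset.sum_range_succ_comm, ← add_assoc]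
      exact ih.trans (add_le_add_left (hstep m) _)
  have hlim : Tendsto (fun m => a m + ∑' k, b k) atTop (𝓝 (∑' k, b k)) := by
    simpa using ha.add tendsto_const_nhds
  exact ge_of_tendsto' hlim fun m => (hpartial m).trans (by gcongr; exact ENNReal.sum_le_tsum _)

section ShellComparison

variable {E : Type*} [NormedAddCommGroup E] [InnerProductSpace ℝ E] [FiniteDimensional ℝ E]
  [MeasurableSpace E] [BorelSpace E] (μ : Measure E) [μ.IsAddHaarMeasure] {Q L : Set E} {ε : ℝ}

theorem addHaar_inter_distLayer_le (hQ : Convex ℝ Q) (hne : Q.Nonempty) (hε : 0 ≤ ε) (k : ℕ) :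
    μ (L ∩ distLayer Q ε k) ≤
      μ (L ∩ distLayer Q ε (k + 1)) + μ (outerShell L ε ∩ distLayer Q ε (k + 1)) := by
  obtain ⟨T, hexp, hmove, hdist⟩ := exists_expanding_map_infDist_add hQ hne hε
  have hmaps : T '' (L ∩ distLayer Q ε k) ⊆
      (L ∩ distLayer Q ε (k + 1)) ∪ (outerShell L ε ∩ distLayer Q ε (k + 1)) := by
    rintro _ ⟨x, ⟨hxL, hxk⟩, rfl⟩
    have hTk : T x ∈ distLayer Q ε (k + 1) := by
      simp only [distLayer, Set.mem_ofPred_eq, Set.mem_Ioc, Nat.cast_add, Nat.cast_one] at hxk ⊢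
      rw [hdist x (hxk.1.trans_le' (by positivity))]
      constructor <;> linarith [hxk.1, hxk.2]
    by_cases hTL : T x ∈ L
    · exact .inl ⟨hTL, hTk⟩
    · exact .inr ⟨⟨(mem_add_smul_closedBall_iff hε).2 ⟨x, hxL, hmove x⟩, hTL⟩, hTk⟩
  calc μ (L ∩ distLayer Q ε k) ≤ μ (T '' (L ∩ distLayer Q ε k)) := by
        simpa using addHaar_le_mul_addHaar_image_of_antilipschitzWith μ hexp _
    _ ≤ _ := (measure_mono hmaps).trans (measure_union_le _ _)

/-- The layers of `L` are pushed outwards one by one by an expanding map; what does not stay in `L`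
lies in the outer shell of `L`, and nothing is left in the limit since `L` has finite volume. -/
theorem addHaar_outerShell_inter_le (hQ : Convex ℝ Q) (hL : Convex ℝ L) (hLfin : μ L ≠ ∞)
    (hε : 0 ≤ ε) : μ (outerShell Q ε ∩ L) ≤ μ (outerShell L ε) := by
  rcases Q.eq_empty_or_nonempty with rfl | hne
  · simp [outerShell]
  have hLmeas : NullMeasurableSet L μ := hL.nullMeasurableSet μ
  have hshell : NullMeasurableSet (outerShell L ε) μ :=
    ((hL.add ((convex_closedBall _ _).smul _)).nullMeasurableSet μ).diff hLmeas
  have hvanish : Tendsto (fun k => μ (L ∩ distLayer Q ε k)) atTop (𝓝 0) :=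
    ENNReal.tendsto_atTop_zero_of_tsum_ne_top
      (ne_top_of_le_ne_top hLfin (tsum_measure_inter_distLayer_le μ Q ε hLmeas))
  calc μ (outerShell Q ε ∩ L)
      ≤ μ (L ∩ distLayer Q ε 0) + μ (frontier Q) :=
        (measure_mono (outerShell_inter_subset hε)).trans (measure_union_le _ _)
    _ = μ (L ∩ distLayer Q ε 0) := by rw [hQ.addHaar_frontier μ, add_zero]
    _ ≤ ∑' k, μ (outerShell L ε ∩ distLayer Q ε (k + 1)) :=
        le_tsum_of_le_succ_add (addHaar_inter_distLayer_le μ hQ hne hε) hvanish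
    _ ≤ ∑' k, μ (outerShell L ε ∩ distLayer Q ε k) :=
        ENNReal.tsum_comp_le_tsum_of_injective (add_left_injective 1) _
    _ ≤ μ (outerShell L ε) := tsum_measure_inter_distLayer_le μ Q ε hshell

end ShellComparison

end OuterShell

/-! ### Log-concave densities -/

section ConvexNull

variable {E : Type*} [NormedAddCommGroup E] [NormedSpace ℝ E] [FiniteDimensional ℝ E]
  [MeasurableSpace E] [BorelSpace E] (μ : Measure E) [μ.IsAddHaarMeasure] {A B : Set E}

theorem interior_nonempty_of_convex_of_addHaar_ne_zero (hB : Convex ℝ B) (h : μ B ≠ 0) :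
    (interior B).Nonempty := by
  by_contra! hempty
  refine h (measure_mono_null ?_ (hB.addHaar_frontier μ))
  rw [frontier, hempty, Set.sdiff_empty]
  exact subset_closure

theorem interior_subset_interior_of_convex_of_addHaar_diff_eq_zero (hB : Convex ℝ B)
    (h : μ (A \ B) = 0) : interior A ⊆ interior B := by
  rcases (interior A).eq_empty_or_nonempty with hA | hA
  · simp [hA]
  have hsub : interior A ⊆ closure B := by
    rw [← Set.sdiff_eq_empty, ← (isOpen_interior.sdiff isClosed_closure).measure_eq_zero_iff μ]
    exact measure_mono_null (Set.sdiff_subset_sdiff interior_subset subset_closure) h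
  have hB0 : μ B ≠ 0 := fun hB0 =>
    (Measure.measure_pos_of_nonempty_interior μ hA).ne'
      (measure_mono_null (Set.subset_sdiff_union A B) (measure_union_null h hB0))
  rw [← hB.interior_closure_eq_interior_of_nonempty_interior
    (interior_nonempty_of_convex_of_addHaar_ne_zero μ hB hB0)]
  exact interior_maximal hsub isOpen_interior

end ConvexNull

theorem tendsto_ofReal_one_add_div_pow_sub_one_div (n : ℕ) (ρ : ℝ) :
    Tendsto (fun ε : ℝ => ENNReal.ofReal ((1 + ε / ρ) ^ n - 1) / ENNReal.ofReal ε) (𝓝[>] 0)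
      (𝓝 (ENNReal.ofReal (n / ρ))) := by
  have hderiv : HasDerivAt (fun ε : ℝ => (1 + ε / ρ) ^ n) (n / ρ) 0 := by
    have h := (((hasDerivAt_id (0 : ℝ)).div_const ρ).const_add 1).fun_pow n
    exact h.congr_deriv (by simp [div_eq_mul_inv])
  refine (ENNReal.tendsto_ofReal hderiv.tendsto_slope_zero_right).congr' ?_
  filter_upwards [self_mem_nhdsWithin] with ε hε
  rw [← ENNReal.ofReal_div_of_pos hε]
  simp [div_eq_inv_mul]

namespace IsLogConcaveDensity

variable {n : ℕ} {f g : EuclideanSpace ℝ (Fin n) → ℝ} {μ : Measure (EuclideanSpace ℝ (Fin n))}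

section LevelSets

theorem convex_levelSet (hf : IsLogConcaveDensity f μ) {t : ℝ} (ht : 0 < t) :
    Convex ℝ (levelSet f t) := by
  intro x hx y hy a b ha hb hab
  obtain rfl : b = 1 - a := by linarith
  calc t = t ^ a * t ^ (1 - a) := by rw [← Real.rpow_add ht, add_sub_cancel, Real.rpow_one]
    _ ≤ f x ^ a * f y ^ (1 - a) :=
      mul_le_mul (Real.rpow_le_rpow ht.le hx ha) (Real.rpow_le_rpow ht.le hy hb)
        (by positivity) (Real.rpow_nonneg (hf.nonneg x) _)
    _ ≤ f (a • x + (1 - a) • y) := hf.logConcave x y a ha (by linarith)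

theorem nullMeasurableSet_levelSet (hf : IsLogConcaveDensity f μ) (t : ℝ) :
    NullMeasurableSet (levelSet f t) := by
  rcases le_or_gt t 0 with ht | ht
  · convert nullMeasurableSet_univ
    exact Set.eq_univ_of_forall fun x => ht.trans (hf.nonneg x)
  · exact (hf.convex_levelSet ht).nullMeasurableSet volume

theorem aemeasurable (hf : IsLogConcaveDensity f μ) : AEMeasurable f :=
  NullMeasurable.aemeasurable <|
    measurable_of_Ici (δ := NullMeasurableSpace (EuclideanSpace ℝ (Fin n)) volume)
      hf.nullMeasurableSet_levelSet

theorem apply_eq (hf : IsLogConcaveDensity f μ) (S : Set (EuclideanSpace ℝ (Fin n))) :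
    μ S = ∫⁻ x in S, ENNReal.ofReal (f x) := by
  rw [hf.eq_withDensity, withDensity_apply']

theorem lintegral_eq_one [IsProbabilityMeasure μ] (hf : IsLogConcaveDensity f μ) :
    ∫⁻ x, ENNReal.ofReal (f x) = 1 := by
  rw [← setLIntegral_univ, ← hf.apply_eq, measure_univ]

theorem absolutelyContinuous (hf : IsLogConcaveDensity f μ) : μ ≪ volume := by
  rw [hf.eq_withDensity]
  exact withDensity_absolutelyContinuous _ _

theorem ae_eq [IsProbabilityMeasure μ] (hf : IsLogConcaveDensity f μ)
    (hg : IsLogConcaveDensity g μ) : f =ᵐ[volume] g := by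
  have h := (withDensity_eq_iff hf.aemeasurable.ennreal_ofReal hg.aemeasurable.ennreal_ofReal
    (by rw [hf.lintegral_eq_one]; exact ENNReal.one_ne_top)).1
    (hf.eq_withDensity.symm.trans hg.eq_withDensity)
  filter_upwards [h] with x hx
  rwa [ENNReal.ofReal_eq_ofReal_iff (hf.nonneg x) (hg.nonneg x)] at hx

theorem ofReal_mul_volume_levelSet_le [IsProbabilityMeasure μ] (hf : IsLogConcaveDensity f μ)
    (t : ℝ) : ENNReal.ofReal t * volume (levelSet f t) ≤ 1 :=
  calc ENNReal.ofReal t * volume (levelSet f t)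
      ≤ ENNReal.ofReal t * volume {x | ENNReal.ofReal t ≤ ENNReal.ofReal (f x)} := by
        gcongr
        exact fun x hx => ENNReal.ofReal_le_ofReal hx
    _ ≤ ∫⁻ x, ENNReal.ofReal (f x) :=
        mul_meas_ge_le_lintegral₀ hf.aemeasurable.ennreal_ofReal _
    _ = 1 := hf.lintegral_eq_one

theorem volume_levelSet_le_ofReal_inv [IsProbabilityMeasure μ] (hf : IsLogConcaveDensity f μ)
    {t : ℝ} (ht : 0 < t) : volume (levelSet f t) ≤ ENNReal.ofReal t⁻¹ := by
  rw [ENNReal.ofReal_inv_of_pos ht, ENNReal.le_inv_iff_mul_le, mul_comm]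
  exact hf.ofReal_mul_volume_levelSet_le t

theorem volume_levelSet_ne_top [IsProbabilityMeasure μ] (hf : IsLogConcaveDensity f μ)
    {t : ℝ} (ht : 0 < t) : volume (levelSet f t) ≠ ∞ :=
  ne_top_of_le_ne_top ENNReal.ofReal_ne_top (hf.volume_levelSet_le_ofReal_inv ht)

theorem exists_volume_levelSet_ne_zero [IsProbabilityMeasure μ] (hf : IsLogConcaveDensity f μ) :
    ∃ a : ℝ, 0 < a ∧ volume (levelSet f a) ≠ 0 := by
  by_contra! hnull
  have hsub : {x | ¬f x ≤ 0} ⊆ ⋃ k : ℕ, levelSet f (1 / ((k : ℝ) + 1)) := fun x hx => by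
    obtain ⟨k, hk⟩ := exists_nat_one_div_lt (not_le.1 hx)
    exact Set.mem_iUnion.2 ⟨k, hk.le⟩
  have hae : ∀ᵐ x, f x ≤ 0 :=
    measure_mono_null hsub (measure_iUnion_null fun k => hnull _ (by positivity))
  have hzero : ∫⁻ x, ENNReal.ofReal (f x) = 0 := by
    rw [lintegral_congr_ae (g := fun _ => 0)
      (by filter_upwards [hae] with x hx using ENNReal.ofReal_of_nonpos hx), lintegral_zero]
  exact one_ne_zero (hf.lintegral_eq_one.symm.trans hzero)

end LevelSets

section Homothety

theorem le_apply_homothety (hf : IsLogConcaveDensity f μ) (x y : EuclideanSpace ℝ (Fin n)) {c : ℝ}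
    (h0 : 0 ≤ c) (h1 : c ≤ 1) :
    f x ^ (1 - c) * f y ^ c ≤ f (AffineMap.homothety x c y) := by
  have hconcave := hf.logConcave x y (1 - c) (sub_nonneg.2 h1) (sub_le_self 1 h0)
  rw [sub_sub_cancel] at hconcave
  convert hconcave using 2
  rw [AffineMap.homothety_apply, vsub_eq_sub, vadd_eq_add]
  module

theorem image_homothety_levelSet_subset (hf : IsLogConcaveDensity f μ)
    (x : EuclideanSpace ℝ (Fin n)) {a c : ℝ} (ha : 0 ≤ a) (h0 : 0 ≤ c) (h1 : c ≤ 1) :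
    AffineMap.homothety x c '' levelSet f a ⊆ levelSet f (f x ^ (1 - c) * a ^ c) := by
  rintro _ ⟨y, hy, rfl⟩
  refine le_trans ?_ (hf.le_apply_homothety x y h0 h1)
  exact mul_le_mul_of_nonneg_left (Real.rpow_le_rpow ha hy h0) (Real.rpow_nonneg (hf.nonneg x) _)

theorem ofReal_pow_mul_volume_levelSet_le (hf : IsLogConcaveDensity f μ)
    (x : EuclideanSpace ℝ (Fin n)) {a c : ℝ} (ha : 0 ≤ a) (h0 : 0 ≤ c) (h1 : c ≤ 1) :
    ENNReal.ofReal (c ^ n) * volume (levelSet f a) ≤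
      volume (levelSet f (f x ^ (1 - c) * a ^ c)) := by
  have h := measure_mono (μ := volume) (hf.image_homothety_levelSet_subset x ha h0 h1)
  rwa [Measure.addHaar_image_homothety, finrank_euclideanSpace_fin,
    abs_of_nonneg (pow_nonneg h0 n)] at h

theorem volume_levelSet_ne_zero [IsProbabilityMeasure μ] (hf : IsLogConcaveDensity f μ) {c : ℝ}
    (hc : 0 ≤ c) {x : EuclideanSpace ℝ (Fin n)} (hx : c < f x) : volume (levelSet f c) ≠ 0 := by
  obtain ⟨a, ha, hvol⟩ := hf.exists_volume_levelSet_ne_zero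
  have hlim : Tendsto (fun s : ℝ => f x ^ (1 - s) * a ^ s) (𝓝[>] 0) (𝓝 (f x)) := by
    have hfx : f x ≠ 0 := (hc.trans_lt hx).ne'
    have hcont : Continuous fun s : ℝ => f x ^ (1 - s) * a ^ s :=
      ((Real.continuous_const_rpow hfx).comp (continuous_const.sub continuous_id)).mul
        (Real.continuous_const_rpow ha.ne')
    simpa using (hcont.tendsto 0).mono_left nhdsWithin_le_nhds
  obtain ⟨s, hs, hs0, hs1⟩ :=
    ((hlim.eventually (lt_mem_nhds hx)).and (Ioc_mem_nhdsGT one_pos)).exists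
  have hpos : 0 < ENNReal.ofReal (s ^ n) * volume (levelSet f a) :=
    ENNReal.mul_pos (by simpa using pow_pos hs0 n) hvol
  exact (hpos.trans_le ((hf.ofReal_pow_mul_volume_levelSet_le x ha.le hs0.le hs1).trans
    (measure_mono fun y hy => hs.le.trans hy))).ne'

/-- If `f x` is large, then so is `f` on the half-size copy with center `x` of a fixed level set,
which is impossible for a density. -/
theorem bddAbove_range [IsProbabilityMeasure μ] (hf : IsLogConcaveDensity f μ) :
    BddAbove (Set.range f) := by
  obtain ⟨a, ha, hvol⟩ := hf.exists_volume_levelSet_ne_zero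
  set v : ℝ := (1 / 2) ^ n * (volume (levelSet f a)).toReal
  have hv : 0 < v :=
    mul_pos (by positivity) (ENNReal.toReal_pos hvol (hf.volume_levelSet_ne_top ha))
  refine ⟨v⁻¹ ^ 2 / a, ?_⟩
  rintro _ ⟨x, rfl⟩
  set s : ℝ := √(f x) * √a
  have hhalf : ENNReal.ofReal v ≤ volume (levelSet f s) := by
    have h := hf.ofReal_pow_mul_volume_levelSet_le x (c := 1 / 2) ha.le (by norm_num) (by norm_num)
    rwa [sub_half, ← Real.sqrt_eq_rpow, ← Real.sqrt_eq_rpow,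
      ← ENNReal.ofReal_toReal (hf.volume_levelSet_ne_top ha),
      ← ENNReal.ofReal_mul (by positivity)] at h
  have hs : s ≤ v⁻¹ := by
    have h : ENNReal.ofReal s * ENNReal.ofReal v ≤ 1 :=
      (mul_le_mul_right hhalf _).trans (hf.ofReal_mul_volume_levelSet_le s)
    rwa [← ENNReal.ofReal_mul (by positivity), ENNReal.ofReal_le_one, ← le_div_iff₀ hv,
      one_div] at h
  calc f x = s ^ 2 / a := by
        rw [mul_pow, Real.sq_sqrt (hf.nonneg x), Real.sq_sqrt ha.le, mul_div_cancel_right₀ _ ha.ne']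
    _ ≤ v⁻¹ ^ 2 / a := by gcongr

theorem exists_isLUB_range_and_eLpNorm_eq [IsProbabilityMeasure μ] (hf : IsLogConcaveDensity f μ) :
    ∃ M : ℝ, 0 < M ∧ IsLUB (Set.range f) M ∧ eLpNorm f ∞ volume = ENNReal.ofReal M := by
  have hM : IsLUB (Set.range f) (sSup (Set.range f)) :=
    isLUB_csSup (Set.range_nonempty f) hf.bddAbove_range
  have hpos : 0 < sSup (Set.range f) := by
    obtain ⟨a, ha, hvol⟩ := hf.exists_volume_levelSet_ne_zero
    obtain ⟨x, hx⟩ := nonempty_of_measure_ne_zero hvol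
    exact (ha.trans_le hx).trans_le (hM.1 (Set.mem_range_self x))
  have hle : eLpNorm f ∞ volume ≤ ENNReal.ofReal (sSup (Set.range f)) := by
    rw [eLpNorm_exponent_top]
    refine eLpNormEssSup_le_of_ae_bound (.of_forall fun x => ?_)
    rw [Real.norm_of_nonneg (hf.nonneg x)]
    exact hM.1 (Set.mem_range_self x)
  have hfin : eLpNorm f ∞ volume ≠ ∞ := ne_top_of_le_ne_top ENNReal.ofReal_ne_top hle
  refine ⟨_, hpos, hM, hle.antisymm (ENNReal.ofReal_le_of_le_toReal (hM.2 ?_))⟩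
  rintro _ ⟨x, rfl⟩
  by_contra! hx
  obtain ⟨c, hc, hcx⟩ := exists_between hx
  refine hf.volume_levelSet_ne_zero (ENNReal.toReal_nonneg.trans hc.le) hcx
    (measure_mono_null (fun y hy => ?_) (meas_eLpNormEssSup_lt (f := f)))
  rw [Set.mem_ofPred_eq, ← eLpNorm_exponent_top, Real.enorm_of_nonneg (hf.nonneg y)]
  exact ENNReal.lt_ofReal_iff_toReal_lt hfin |>.2 (hc.trans_le hy)

end Homothety

section PerimeterBound

theorem volume_outerShell_inter_levelSet_le [IsProbabilityMeasure μ]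
    (hf : IsLogConcaveDensity f μ) {s ρ : ℝ} (hs : 0 < s) (hρ : 0 < ρ)
    {y : EuclideanSpace ℝ (Fin n)} (hball : Metric.closedBall y ρ ⊆ levelSet f s)
    {Q : Set (EuclideanSpace ℝ (Fin n))} (hQ : Convex ℝ Q) {ε : ℝ} (hε : 0 < ε) :
    volume (outerShell Q ε ∩ levelSet f s) ≤
      ENNReal.ofReal ((1 + ε / ρ) ^ n - 1) * volume (levelSet f s) := by
  have hconv := hf.convex_levelSet hs
  have hfin := hf.volume_levelSet_ne_top hs
  refine (addHaar_outerShell_inter_le volume hQ hconv hfin hε.le).trans ?_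
  simpa using addHaar_outerShell_le volume hconv hfin hρ hball hε

theorem measure_outerShell_le [IsProbabilityMeasure μ] (hf : IsLogConcaveDensity f μ) {M t ρ : ℝ}
    (hM : M ∈ upperBounds (Set.range f)) (ht : 0 < t) (hρ : 0 < ρ) {y : EuclideanSpace ℝ (Fin n)}
    (hball : Metric.closedBall y ρ ⊆ levelSet f t) {Q : Set (EuclideanSpace ℝ (Fin n))}
    (hQ : Convex ℝ Q) {ε : ℝ} (hε : 0 < ε) :
    μ (outerShell Q ε) ≤ ENNReal.ofReal ((1 + ε / ρ) ^ n - 1) *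
      (1 + ENNReal.ofReal M * volume (levelSet f t)) := by
  set G := ENNReal.ofReal ((1 + ε / ρ) ^ n - 1)
  have hshell : NullMeasurableSet (outerShell Q ε) volume :=
    ((hQ.add ((convex_closedBall _ _).smul _)).nullMeasurableSet volume).diff
      (hQ.nullMeasurableSet volume)
  have hlow (s : ℝ) (hs : 0 < s) (hst : s ≤ t) :
      volume (outerShell Q ε ∩ levelSet f s) ≤ G * volume (levelSet f s) :=
    hf.volume_outerShell_inter_levelSet_le hs hρ (hball.trans fun x hx => hst.trans hx) hQ hε
  have hlevel : ∀ s ∈ Set.Ioi (0 : ℝ), volume.restrict (outerShell Q ε) {x | s ≤ f x} ≤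
      G * volume {x | s ≤ f x} +
        (Set.Ioc 0 M).indicator (fun _ => G * volume (levelSet f t)) s := by
    intro s hs
    rw [Measure.restrict_apply₀' hshell, Set.inter_comm]
    rcases le_or_gt s t with hst | hts
    · exact (hlow s hs hst).trans le_self_add
    rcases le_or_gt s M with hsM | hMs
    · rw [Set.indicator_of_mem (Set.mem_Ioc.2 ⟨hs, hsM⟩)]
      refine le_add_left ((measure_mono ?_).trans (hlow t ht le_rfl))
      exact Set.inter_subset_inter_right _ fun x hx => hts.le.trans hx
    · have hempty : {x | s ≤ f x} = ∅ := Set.eq_empty_of_forall_notMem fun x hx =>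
        (hM (Set.mem_range_self x)).not_gt (hMs.trans_le hx)
      simp [hempty]
  have hnonneg (ν : Measure (EuclideanSpace ℝ (Fin n))) : 0 ≤ᵐ[ν] f := .of_forall hf.nonneg
  calc μ (outerShell Q ε)
      = ∫⁻ s in Set.Ioi 0, volume.restrict (outerShell Q ε) {x | s ≤ f x} := by
        rw [hf.apply_eq, lintegral_eq_lintegral_meas_le _ (hnonneg _) hf.aemeasurable.restrict]
    _ ≤ ∫⁻ s in Set.Ioi 0, (G * volume {x | s ≤ f x} +
          (Set.Ioc 0 M).indicator (fun _ => G * volume (levelSet f t)) s) :=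
        setLIntegral_mono' measurableSet_Ioi hlevel
    _ = G * (∫⁻ x, ENNReal.ofReal (f x)) + G * volume (levelSet f t) * volume (Set.Ioc 0 M) := by
        rw [lintegral_add_right _ (measurable_const.indicator measurableSet_Ioc),
          lintegral_const_mul' _ _ ENNReal.ofReal_ne_top,
          ← lintegral_eq_lintegral_meas_le _ (hnonneg _) hf.aemeasurable,
          lintegral_indicator measurableSet_Ioc, Measure.restrict_restrict measurableSet_Ioc,
          Set.inter_eq_left.2 Set.Ioc_subset_Ioi_self, setLIntegral_const]
    _ = G * (1 + ENNReal.ofReal M * volume (levelSet f t)) := by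
        rw [hf.lintegral_eq_one, Real.volume_Ioc, sub_zero]
        ring

theorem maxPerimeter_le [IsProbabilityMeasure μ] (hf : IsLogConcaveDensity f μ) {t ρ : ℝ}
    (ht : 0 < t) (hρ : 0 < ρ) {y : EuclideanSpace ℝ (Fin n)}
    (hball : Metric.closedBall y ρ ⊆ levelSet f t) :
    maxPerimeter μ ≤
      ENNReal.ofReal (n / ρ) * (1 + eLpNorm f ∞ volume * volume (levelSet f t)) := by
  obtain ⟨M, -, hM, hnorm⟩ := hf.exists_isLUB_range_and_eLpNorm_eq
  rw [hnorm]
  set K := 1 + ENNReal.ofReal M * volume (levelSet f t)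
  have hK : K ≠ ∞ := by
    simpa [K] using ENNReal.mul_ne_top ENNReal.ofReal_ne_top (hf.volume_levelSet_ne_top ht)
  refine iSup₂_le fun Q hQ => ?_
  have hlim := ENNReal.Tendsto.mul_const (tendsto_ofReal_one_add_div_pow_sub_one_div n ρ)
    (.inr hK)
  refine (liminf_le_liminf ?_).trans hlim.liminf_eq.le
  filter_upwards [self_mem_nhdsWithin] with ε hε
  rw [← ENNReal.mul_div_right_comm]
  gcongr
  exact hf.measure_outerShell_le hM.1 ht hρ hball hQ hε

end PerimeterBound

end IsLogConcaveDensity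

/-! ### A large and a small level set of comparable volume -/

theorem lintegral_comp_homothety {E : Type*} [NormedAddCommGroup E] [NormedSpace ℝ E]
    [FiniteDimensional ℝ E] [MeasurableSpace E] [BorelSpace E] (μ : Measure E)
    [μ.IsAddHaarMeasure] (g : E → ℝ≥0∞) (x₀ : E) {c : ℝ} (hc : c ≠ 0) :
    ∫⁻ x, g (AffineMap.homothety x₀ c x) ∂μ =
      ENNReal.ofReal |(c ^ Module.finrank ℝ E)⁻¹| * ∫⁻ x, g x ∂μ := by
  have hform (x : E) : AffineMap.homothety x₀ c x = c • x + (1 - c) • x₀ := by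
    rw [AffineMap.homothety_apply, vsub_eq_sub, vadd_eq_add]
    module
  simp_rw [hform]
  rw [← (measurableEmbedding_const_smul₀ hc).lintegral_map (fun x => g (x + (1 - c) • x₀)),
    Measure.map_addHaar_smul μ hc, lintegral_smul_measure, lintegral_add_right_eq_self g,
    smul_eq_mul]

namespace IsLogConcaveDensity

variable {n : ℕ} {f : EuclideanSpace ℝ (Fin n) → ℝ} {μ : Measure (EuclideanSpace ℝ (Fin n))}

theorem apply_le_mul_apply_homothety_half (hf : IsLogConcaveDensity f μ) {M t : ℝ} (hM : 0 < M)
    {x₀ x : EuclideanSpace ℝ (Fin n)} (hx₀ : M / 4 ≤ f x₀) (hx : f x ≤ t) :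
    f x ≤ 2 * √(t / M) * f (AffineMap.homothety x₀ (1 / 2 : ℝ) x) := by
  have hhalf := hf.le_apply_homothety x₀ x (c := 1 / 2) (by norm_num) (by norm_num)
  rw [sub_half, ← Real.sqrt_eq_rpow, ← Real.sqrt_eq_rpow] at hhalf
  have ht : √t = √(t / M) * √M := by
    rw [← Real.sqrt_mul' _ hM.le, div_mul_cancel₀ _ hM.ne']
  have hsqrt : √M ≤ 2 * √(f x₀) := by
    rw [Real.sqrt_le_left (by positivity), mul_pow, Real.sq_sqrt (hf.nonneg x₀)]
    linarith
  calc f x = √(f x) * √(f x) := (Real.mul_self_sqrt (hf.nonneg x)).symm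
    _ ≤ √t * √(f x) := by gcongr
    _ = √(t / M) * √M * √(f x) := by rw [ht]
    _ ≤ √(t / M) * (2 * √(f x₀)) * √(f x) := by gcongr
    _ = 2 * √(t / M) * (√(f x₀) * √(f x)) := by ring
    _ ≤ 2 * √(t / M) * f (AffineMap.homothety x₀ (1 / 2 : ℝ) x) := by gcongr

theorem measure_compl_levelSet_le [IsProbabilityMeasure μ] (hf : IsLogConcaveDensity f μ)
    {M : ℝ} (hM : 0 < M) (hlub : IsLUB (Set.range f) M) (t : ℝ) :
    μ (levelSet f t)ᶜ ≤ ENNReal.ofReal (2 ^ (n + 1) * √(t / M)) := by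
  obtain ⟨_, ⟨x₀, rfl⟩, hx₀⟩ := (lt_isLUB_iff hlub).1 (show M / 4 < M by linarith)
  have hpoint (x) (hx : x ∈ (levelSet f t)ᶜ) : ENNReal.ofReal (f x) ≤
      ENNReal.ofReal (2 * √(t / M)) *
        ENNReal.ofReal (f (AffineMap.homothety x₀ (1 / 2 : ℝ) x)) := by
    rw [← ENNReal.ofReal_mul (by positivity)]
    exact ENNReal.ofReal_le_ofReal
      (hf.apply_le_mul_apply_homothety_half hM hx₀.le (le_of_not_ge hx))
  rw [hf.apply_eq]
  calc ∫⁻ x in (levelSet f t)ᶜ, ENNReal.ofReal (f x)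
      ≤ ∫⁻ x in (levelSet f t)ᶜ, ENNReal.ofReal (2 * √(t / M)) *
          ENNReal.ofReal (f (AffineMap.homothety x₀ (1 / 2 : ℝ) x)) := by
        refine lintegral_mono_ae ?_
        filter_upwards [ae_restrict_mem₀ (hf.nullMeasurableSet_levelSet t).compl] with x hx
          using hpoint x hx
    _ ≤ ∫⁻ x, ENNReal.ofReal (2 * √(t / M)) *
          ENNReal.ofReal (f (AffineMap.homothety x₀ (1 / 2 : ℝ) x)) := setLIntegral_le_lintegral _ _
    _ = ENNReal.ofReal (2 ^ (n + 1) * √(t / M)) := by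
        rw [lintegral_const_mul' _ _ ENNReal.ofReal_ne_top,
          lintegral_comp_homothety volume (fun x => ENNReal.ofReal (f x)) x₀ (by norm_num),
          hf.lintegral_eq_one, mul_one, finrank_euclideanSpace_fin,
          ← ENNReal.ofReal_mul (by positivity), abs_of_nonneg (by positivity), one_div, inv_pow,
          inv_inv, pow_succ]
        ring_nf

theorem volume_levelSet_mul_le (hf : IsLogConcaveDensity f μ) {M τ : ℝ} (hM : 0 < M)
    (hlub : IsLUB (Set.range f) M) (h0 : 0 < τ) (h1 : τ < 1) :
    volume (levelSet f (M * τ)) ≤ 2 ^ n * volume (levelSet f (M * τ ^ (2 / 3 : ℝ))) := by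
  obtain ⟨_, ⟨x₀, rfl⟩, hx₀⟩ := (lt_isLUB_iff hlub).1 <|
    mul_lt_of_lt_one_right hM (Real.rpow_lt_one h0.le h1 (show (0 : ℝ) < 1 / 3 by norm_num))
  have hlevel : M * τ ^ (2 / 3 : ℝ) ≤ f x₀ ^ (1 - 1 / 2 : ℝ) * (M * τ) ^ (1 / 2 : ℝ) :=
    calc M * τ ^ (2 / 3 : ℝ)
        = M ^ (1 / 2 + 1 / 2 : ℝ) * τ ^ (1 / 3 * (1 / 2) + 1 / 2 : ℝ) := by norm_num
      _ = (M * τ ^ (1 / 3 : ℝ)) ^ (1 - 1 / 2 : ℝ) * (M * τ) ^ (1 / 2 : ℝ) := by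
        rw [Real.mul_rpow hM.le (by positivity), Real.mul_rpow hM.le h0.le, ← Real.rpow_mul h0.le,
          Real.rpow_add hM, Real.rpow_add h0, sub_half]
        ring
      _ ≤ f x₀ ^ (1 - 1 / 2 : ℝ) * (M * τ) ^ (1 / 2 : ℝ) := by gcongr
  have htwo : (2 : ℝ≥0∞) ^ n * ENNReal.ofReal ((1 / 2) ^ n) = 1 := by
    rw [ENNReal.ofReal_pow (by norm_num), ← mul_pow, ← ENNReal.ofReal_ofNat 2,
      ← ENNReal.ofReal_mul (by norm_num)]
    norm_num
  calc volume (levelSet f (M * τ))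
      = 2 ^ n * (ENNReal.ofReal ((1 / 2) ^ n) * volume (levelSet f (M * τ))) := by
        rw [← mul_assoc, htwo, one_mul]
    _ ≤ 2 ^ n * volume (levelSet f (f x₀ ^ (1 - 1 / 2 : ℝ) * (M * τ) ^ (1 / 2 : ℝ))) := by
        gcongr
        exact hf.ofReal_pow_mul_volume_levelSet_le x₀ (by positivity) (by norm_num) (by norm_num)
    _ ≤ 2 ^ n * volume (levelSet f (M * τ ^ (2 / 3 : ℝ))) := by
        gcongr
        exact fun x hx => hlevel.trans hx

/-- Raising `u` repeatedly to the power `2 / 3` moves it from `τ` towards `1` in steps which change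
the volume of the level set at `M * u` by a factor of at most `2 ^ n`. -/
theorem exists_volume_levelSet_mul_le [IsProbabilityMeasure μ] (hf : IsLogConcaveDensity f μ)
    {M τ : ℝ} (hM : 0 < M) (hlub : IsLUB (Set.range f) M) (h0 : 0 < τ) (h1 : τ < 1) :
    ∃ u, τ ≤ u ∧ u < 1 ∧ volume (levelSet f (M * u)) ≤ ENNReal.ofReal (2 / M) ∧
      (u = τ ∨ ENNReal.ofReal (2 / M) ≤ 2 ^ n * volume (levelSet f (M * u))) := by
  set u : ℕ → ℝ := fun k => τ ^ ((2 / 3 : ℝ) ^ k)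
  have hpos (k) : 0 < u k := Real.rpow_pos_of_pos h0 _
  have hlt (k) : u k < 1 := Real.rpow_lt_one h0.le h1 (by positivity)
  have hle (k) : τ ≤ u k := by
    simpa using Real.rpow_le_rpow_of_exponent_ge h0 h1.le
      (pow_le_one₀ (by norm_num) (by norm_num) : (2 / 3 : ℝ) ^ k ≤ 1)
  have hzero : u 0 = τ := by simp [u]
  have hsucc (k) : u k ^ (2 / 3 : ℝ) = u (k + 1) := by
    simp only [u, ← Real.rpow_mul h0.le, pow_succ]
  have hlim : Tendsto u atTop (𝓝 1) := by
    have h := ((Real.continuous_const_rpow h0.ne').tendsto 0).comp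
      (tendsto_pow_atTop_nhds_zero_of_lt_one (r := (2 / 3 : ℝ)) (by norm_num) (by norm_num))
    simpa [Function.comp_def] using h
  have hsmall : ∃ k, volume (levelSet f (M * u k)) ≤ ENNReal.ofReal (2 / M) := by
    obtain ⟨k, hk⟩ := (hlim.eventually (lt_mem_nhds (show (1 / 2 : ℝ) < 1 by norm_num))).exists
    refine ⟨k, (hf.volume_levelSet_le_ofReal_inv (mul_pos hM (hpos k))).trans
      (ENNReal.ofReal_le_ofReal ?_)⟩
    rw [inv_eq_one_div, div_le_div_iff₀ (mul_pos hM (hpos k)) hM]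
    nlinarith
  by_cases hτ : volume (levelSet f (M * τ)) ≤ ENNReal.ofReal (2 / M)
  · exact ⟨τ, le_rfl, h1, hτ, .inl rfl⟩
  obtain ⟨k, hlarge, hnext⟩ :=
    Nat.exists_not_and_succ_of_not_zero_of_exists (hzero.symm ▸ hτ) hsmall
  refine ⟨u (k + 1), hle _, hlt _, hnext, .inr ((not_le.1 hlarge).le.trans ?_)⟩
  rw [← hsucc]
  exact hf.volume_levelSet_mul_le hM hlub (hpos k) (hlt k)

theorem exists_volume_levelSet_mul_le_mul [IsProbabilityMeasure μ] (hf : IsLogConcaveDensity f μ)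
    {M τ : ℝ} (hM : 0 < M) (hlub : IsLUB (Set.range f) M) (h0 : 0 < τ) (h1 : τ < 1) :
    ∃ u, τ ≤ u ∧ u < 1 ∧ volume (levelSet f (M * u)) ≤ ENNReal.ofReal (2 / M) ∧
      volume (levelSet f (M * τ)) ≤
        ENNReal.ofReal (max 1 (2 ^ n / (2 * τ))) * volume (levelSet f (M * u)) := by
  obtain ⟨u, hτu, hu1, hu, rfl | hlarge⟩ := hf.exists_volume_levelSet_mul_le hM hlub h0 h1
  · refine ⟨u, hτu, hu1, hu, le_mul_of_one_le_left' ?_⟩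
    rw [ENNReal.one_le_ofReal]
    exact le_max_left _ _
  refine ⟨u, hτu, hu1, hu, ?_⟩
  calc volume (levelSet f (M * τ))
      ≤ ENNReal.ofReal (M * τ)⁻¹ := hf.volume_levelSet_le_ofReal_inv (mul_pos hM h0)
    _ = ENNReal.ofReal (2 * τ)⁻¹ * ENNReal.ofReal (2 / M) := by
        rw [← ENNReal.ofReal_mul (by positivity)]
        congr 1
        field_simp
    _ ≤ ENNReal.ofReal (2 * τ)⁻¹ * (2 ^ n * volume (levelSet f (M * u))) := by gcongr
    _ = ENNReal.ofReal (2 ^ n / (2 * τ)) * volume (levelSet f (M * u)) := by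
        rw [div_eq_inv_mul, ENNReal.ofReal_mul (by positivity), ENNReal.ofReal_pow (by norm_num),
          ENNReal.ofReal_ofNat, mul_assoc]
    _ ≤ ENNReal.ofReal (max 1 (2 ^ n / (2 * τ))) * volume (levelSet f (M * u)) := by
        gcongr
        exact le_max_right _ _

theorem exists_levels_of_comparable_volume [IsProbabilityMeasure μ] (hn : n ≠ 0)
    (hf : IsLogConcaveDensity f μ) {δ : ℝ} (hδ : 0 < δ) (hδ1 : δ ≤ 1) :
    ∃ t₀ t₁ : ℝ, 0 < t₁ ∧ t₁ ≤ t₀ ∧ ENNReal.ofReal t₀ < eLpNorm f ∞ volume ∧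
      μ (levelSet f t₁)ᶜ ≤ ENNReal.ofReal δ ∧
      volume (levelSet f t₀) ≤ ENNReal.ofReal 2 / eLpNorm f ∞ volume ∧
      volume (levelSet f t₁) ≤ ENNReal.ofReal ((16 / δ ^ 2) ^ n) * volume (levelSet f t₀) := by
  obtain ⟨M, hM, hlub, hnorm⟩ := hf.exists_isLUB_range_and_eLpNorm_eq
  set τ : ℝ := (δ / 2 ^ (n + 1)) ^ 2
  have hτ0 : 0 < τ := by positivity
  have hτ1 : τ < 1 := by
    refine pow_lt_one₀ (by positivity) ?_ two_ne_zero
    exact (div_lt_one (by positivity)).2 (hδ1.trans_lt (one_lt_pow₀ one_lt_two n.succ_ne_zero))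
  obtain ⟨u, hτu, hu1, hu, hcomp⟩ := hf.exists_volume_levelSet_mul_le_mul hM hlub hτ0 hτ1
  rw [hnorm]
  refine ⟨M * u, M * τ, by positivity, by gcongr, ?_, ?_, ?_, hcomp.trans ?_⟩
  · exact (ENNReal.ofReal_lt_ofReal_iff hM).2 (mul_lt_of_lt_one_right hM hu1)
  · refine (hf.measure_compl_levelSet_le hM hlub (M * τ)).trans (ENNReal.ofReal_le_ofReal ?_)
    rw [mul_div_cancel_left₀ _ hM.ne', Real.sqrt_sq (by positivity),
      mul_div_cancel₀ _ (by positivity)]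
  · rwa [← ENNReal.ofReal_div_of_pos hM]
  · gcongr
    have hsq : 1 ≤ 1 / δ ^ 2 := (one_le_div (by positivity)).2 (pow_le_one₀ hδ.le hδ1)
    refine max_le (one_le_pow₀ (by rw [div_eq_mul_one_div]; linarith)) ?_
    calc 2 ^ n / (2 * τ) = 8 ^ n * 2 * (1 / δ ^ 2) := by
          rw [show (8 : ℝ) ^ n = 2 ^ n * 2 ^ n * 2 ^ n by rw [← mul_pow, ← mul_pow]; norm_num]
          simp only [τ]
          field_simp
          ring
      _ ≤ 8 ^ n * 2 ^ n * (1 / δ ^ 2) ^ n := by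
          gcongr
          exacts [le_self_pow₀ one_le_two hn, le_self_pow₀ hsq hn]
      _ = (16 / δ ^ 2) ^ n := by rw [← mul_pow, ← mul_pow]; ring_nf

end IsLogConcaveDensity

/-! ### Moments of isotropic log-concave measures -/

section Moments

variable {α : Type*} [MeasurableSpace α] {ν : Measure α} [IsProbabilityMeasure ν] {Y : α → ℝ}

/-- The Paley–Zygmund inequality. The weight `m / c`, with `c = ∫ Y - a`, is the optimal one in the
AM-GM bound `Y ≤ (m / c + Y ^ 2 * (c / m)) / 2` on the set where `Y` exceeds `a`. -/
theorem sq_integral_sub_le_mul_measureReal_lt (hYm : Measurable Y) (hY : Integrable Y ν)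
    (hY2 : Integrable (fun x => Y x ^ 2) ν) {a m : ℝ} (ha : 0 ≤ a) (haY : a < ∫ x, Y x ∂ν)
    (hm : 0 < m) (hYm2 : ∫ x, Y x ^ 2 ∂ν ≤ m) :
    (∫ x, Y x ∂ν - a) ^ 2 ≤ m * ν.real {x | a < Y x} := by
  set S := {x | a < Y x}
  have hS : MeasurableSet S := measurableSet_lt measurable_const hYm
  set c := ∫ x, Y x ∂ν - a
  have hc : 0 < c := sub_pos.2 haY
  have hpoint (x) : Y x - a ≤ S.indicator (fun _ => m / c / 2) x + Y x ^ 2 * (c / m / 2) := by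
    by_cases hx : x ∈ S
    · have hamgm : m / c / 2 + Y x ^ 2 * (c / m / 2) - Y x = (Y x * c - m) ^ 2 / (2 * c * m) := by
        field_simp
        ring
      have hpos : 0 ≤ (Y x * c - m) ^ 2 / (2 * c * m) := by positivity
      rw [Set.indicator_of_mem hx]
      linarith
    · rw [Set.indicator_of_notMem hx, zero_add]
      exact (sub_nonpos.2 (not_lt.1 hx)).trans (by positivity)
  have hint := integral_mono (hY.sub (integrable_const a))
    (((integrable_const (m / c / 2)).indicator hS).add (hY2.mul_const (c / m / 2))) hpoint
  simp only [Pi.add_apply, Pi.sub_apply] at hint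
  rw [integral_sub hY (integrable_const a), integral_add
    ((integrable_const _).indicator hS) (hY2.mul_const _), integral_const, probReal_univ,
    one_smul, integral_indicator hS, setIntegral_const, integral_mul_const, smul_eq_mul] at hint
  have hsecond : (∫ x, Y x ^ 2 ∂ν) * (c / m / 2) ≤ c / 2 :=
    calc (∫ x, Y x ^ 2 ∂ν) * (c / m / 2) ≤ m * (c / m / 2) := by gcongr
      _ = c / 2 := by field_simp
  have hc_le : c ≤ ν.real S * (m / c) := by linarith
  calc c ^ 2 = c * c := sq c
    _ ≤ ν.real S * (m / c) * c := by gcongr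
    _ = m * ν.real S := by field_simp

theorem lintegral_sq_le_of_measure_lt_le (hYm : Measurable Y) (hY : ∀ x, 0 ≤ Y x) {a k : ℝ}
    {c : ℝ≥0∞} (hk : 0 < k) (hc : c ≠ ∞)
    (htail : ∀ r, a ≤ r → ν {x | k * r < Y x} ≤ c * ν {x | r < Y x}) :
    ∫⁻ x, ENNReal.ofReal (Y x ^ 2) ∂ν ≤
      ENNReal.ofReal (k ^ 2) *
        (ENNReal.ofReal (a ^ 2) + c * ∫⁻ x, ENNReal.ofReal (Y x ^ 2) ∂ν) := by
  have hlevel : ∀ v ∈ Set.Ioi (0 : ℝ), ν {x | v < (Y x / k) ^ 2} ≤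
      (Set.Ioc 0 (a ^ 2)).indicator (fun _ => 1) v + c * ν {x | v < Y x ^ 2} := by
    intro v hv
    rcases le_or_gt v (a ^ 2) with hva | hva
    · rw [Set.indicator_of_mem (Set.mem_Ioc.2 ⟨hv, hva⟩)]
      exact prob_le_one.trans le_self_add
    refine le_add_left ((measure_mono fun x hx => ?_).trans ((htail √v (Real.le_sqrt_of_sq_le
      hva.le)).trans (mul_le_mul_right (measure_mono fun x hx => Real.lt_sq_of_sqrt_lt hx) _)))
    have hlt := Real.sqrt_lt_sqrt (Set.mem_Ioi.1 hv).le hx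
    rwa [Real.sqrt_sq (div_nonneg (hY x) hk.le), lt_div_iff₀' hk] at hlt
  calc ∫⁻ x, ENNReal.ofReal (Y x ^ 2) ∂ν
      = ENNReal.ofReal (k ^ 2) * ∫⁻ x, ENNReal.ofReal ((Y x / k) ^ 2) ∂ν := by
        rw [← lintegral_const_mul' _ _ ENNReal.ofReal_ne_top]
        refine lintegral_congr fun x => ?_
        rw [← ENNReal.ofReal_mul (by positivity), ← mul_pow, mul_div_cancel₀ _ hk.ne']
    _ = ENNReal.ofReal (k ^ 2) * ∫⁻ v in Set.Ioi 0, ν {x | v < (Y x / k) ^ 2} := by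
        rw [lintegral_eq_lintegral_meas_lt ν (.of_forall fun x => sq_nonneg _)
          ((hYm.div_const k).pow_const 2).aemeasurable]
    _ ≤ ENNReal.ofReal (k ^ 2) * ∫⁻ v in Set.Ioi 0,
          ((Set.Ioc 0 (a ^ 2)).indicator (fun _ => 1) v + c * ν {x | v < Y x ^ 2}) := by
        gcongr 1
        exact setLIntegral_mono' measurableSet_Ioi hlevel
    _ = ENNReal.ofReal (k ^ 2) *
          (ENNReal.ofReal (a ^ 2) + c * ∫⁻ x, ENNReal.ofReal (Y x ^ 2) ∂ν) := by
        rw [lintegral_add_left (measurable_const.indicator measurableSet_Ioc),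
          lintegral_const_mul' _ _ hc,
          ← lintegral_eq_lintegral_meas_lt ν (.of_forall fun x => sq_nonneg _)
            (hYm.pow_const 2).aemeasurable,
          lintegral_indicator measurableSet_Ioc, Measure.restrict_restrict measurableSet_Ioc,
          Set.inter_eq_left.2 Set.Ioc_subset_Ioi_self, setLIntegral_const, one_mul,
          Real.volume_Ioc, sub_zero]

end Moments

namespace IsLogConcaveMeasure

variable {n : ℕ} {μ : Measure (EuclideanSpace ℝ (Fin n))}

theorem measure_lt_mul_measure_le_le_sq (hlc : IsLogConcaveMeasure μ)
    {p : Seminorm ℝ (EuclideanSpace ℝ (Fin n))} (hp : Measurable p) (r : ℝ) :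
    μ {x | 3 * r < p x} * μ {x | p x ≤ r} ≤ μ {x | r < p x} ^ 2 := by
  set A := {x | 3 * r < p x}
  set B := {x | p x ≤ r}
  have hsub : (1 / 2 : ℝ) • A + (1 - 1 / 2 : ℝ) • B ⊆ {x | r < p x} := by
    rintro _ ⟨_, ⟨x, hx, rfl⟩, _, ⟨y, hy, rfl⟩, rfl⟩
    simp only [A, B, Set.mem_ofPred_eq] at hx hy ⊢
    have htri := map_sub_le_add p ((1 / 2 : ℝ) • x + (1 - 1 / 2 : ℝ) • y) ((1 - 1 / 2 : ℝ) • y)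
    rw [add_sub_cancel_right, map_smul_eq_mul, map_smul_eq_mul] at htri
    norm_num at htri ⊢
    linarith
  have hhalf := (hlc A B (measurableSet_lt measurable_const hp) (measurableSet_le hp
    measurable_const) (1 / 2) (by norm_num) (by norm_num)).trans (measure_mono hsub)
  have hsq := pow_le_pow_left₀ zero_le hhalf 2
  rwa [sub_half, mul_pow, ← ENNReal.rpow_mul_natCast, ← ENNReal.rpow_mul_natCast,
    Nat.cast_ofNat, one_div_mul_cancel two_ne_zero, ENNReal.rpow_one, ENNReal.rpow_one] at hsq

theorem measure_three_mul_lt_le [IsProbabilityMeasure μ] (hlc : IsLogConcaveMeasure μ)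
    {p : Seminorm ℝ (EuclideanSpace ℝ (Fin n))} (hp : Measurable p) {r ε : ℝ} (hε : 0 ≤ ε)
    (hε1 : ε < 1) (htail : μ {x | r < p x} ≤ ENNReal.ofReal ε) :
    μ {x | 3 * r < p x} ≤ ENNReal.ofReal (ε / (1 - ε)) * μ {x | r < p x} := by
  have hpos : 0 < 1 - ε := sub_pos.2 hε1
  have hcore : ENNReal.ofReal (1 - ε) ≤ μ {x | p x ≤ r} := by
    rw [show {x | p x ≤ r} = {x | r < p x}ᶜ by ext; simp,
      prob_compl_eq_one_sub (measurableSet_lt measurable_const hp), ENNReal.ofReal_sub _ hε,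
      ENNReal.ofReal_one]
    exact tsub_le_tsub_left htail 1
  rw [ENNReal.ofReal_div_of_pos hpos, ← ENNReal.mul_div_right_comm, ENNReal.le_div_iff_mul_le
    (.inl (by simpa using hε1)) (.inl ENNReal.ofReal_ne_top)]
  calc μ {x | 3 * r < p x} * ENNReal.ofReal (1 - ε)
      ≤ μ {x | 3 * r < p x} * μ {x | p x ≤ r} := by gcongr
    _ ≤ μ {x | r < p x} ^ 2 := hlc.measure_lt_mul_measure_le_le_sq hp r
    _ ≤ ENNReal.ofReal ε * μ {x | r < p x} := by
        rw [sq]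
        gcongr

end IsLogConcaveMeasure

section Separation

variable {E : Type*} [NormedAddCommGroup E] [InnerProductSpace ℝ E] [CompleteSpace E]

theorem exists_norm_eq_one_forall_inner_lt {D : Set E} (hD : Convex ℝ D) (hne : D.Nonempty) {x : E}
    (hx : x ∉ closure D) : ∃ θ : E, ‖θ‖ = 1 ∧ ∀ z ∈ D, inner ℝ z θ < inner ℝ x θ := by
  obtain ⟨g, u, hgD, hgx⟩ := geometric_hahn_banach_closed_point hD.closure isClosed_closure hx
  set v := (InnerProductSpace.toDual ℝ E).symm g
  have hgv (z : E) : g z = inner ℝ z v := by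
    rw [real_inner_comm, InnerProductSpace.toDual_symm_apply]
  have hlt (z) (hz : z ∈ D) : inner ℝ z v < inner ℝ x v := by
    simpa only [hgv] using (hgD z (subset_closure hz)).trans hgx
  have hv : v ≠ 0 := by
    obtain ⟨z, hz⟩ := hne
    rintro hv
    simpa [hv] using hlt z hz
  refine ⟨‖v‖⁻¹ • v, norm_smul_inv_norm hv, fun z hz => ?_⟩
  simp only [real_inner_smul_right]
  exact mul_lt_mul_of_pos_left (hlt z hz) (inv_pos.2 (norm_pos_iff.2 hv))

end Separation

namespace IsIsotropicMeasure

variable {n : ℕ} {μ : Measure (EuclideanSpace ℝ (Fin n))} {θ : EuclideanSpace ℝ (Fin n)}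

theorem integrable_inner_sq (hμ : IsIsotropicMeasure μ) (hθ : ‖θ‖ = 1) :
    Integrable (fun x => inner ℝ x θ ^ 2) μ :=
  .of_integral_ne_zero (by simp [hμ.second_moment θ hθ])

theorem lintegral_inner_sq (hμ : IsIsotropicMeasure μ) (hθ : ‖θ‖ = 1) :
    ∫⁻ x, ENNReal.ofReal (inner ℝ x θ ^ 2) ∂μ = 1 := by
  rw [← ofReal_integral_eq_lintegral_ofReal (hμ.integrable_inner_sq hθ)
    (.of_forall fun x => sq_nonneg _), hμ.second_moment θ hθ, ENNReal.ofReal_one]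

theorem integrable_apply_sq (hμ : IsIsotropicMeasure μ) (i : Fin n) :
    Integrable (fun x => x i ^ 2) μ := by
  simpa [EuclideanSpace.inner_single_right] using
    hμ.integrable_inner_sq (θ := EuclideanSpace.single i 1) (by simp)

theorem integral_apply_sq (hμ : IsIsotropicMeasure μ) (i : Fin n) : ∫ x, x i ^ 2 ∂μ = 1 := by
  simpa [EuclideanSpace.inner_single_right] using
    hμ.second_moment (EuclideanSpace.single i 1) (by simp)

theorem integrable_id (hμ : IsIsotropicMeasure μ) :
    Integrable (fun x : EuclideanSpace ℝ (Fin n) => x) μ := by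
  have := hμ.isProbabilityMeasure
  have hbound : Integrable (fun x : EuclideanSpace ℝ (Fin n) => 1 + ∑ i, x i ^ 2) μ :=
    (integrable_const 1).add (integrable_finsetSum _ fun i _ => hμ.integrable_apply_sq i)
  refine hbound.mono' aestronglyMeasurable_id (.of_forall fun x => ?_)
  rw [← EuclideanSpace.real_norm_sq_eq]
  nlinarith [sq_nonneg (‖x‖ - 1)]

theorem integrable_inner (hμ : IsIsotropicMeasure μ) (θ : EuclideanSpace ℝ (Fin n)) :
    Integrable (fun x => inner ℝ x θ) μ :=
  hμ.integrable_id.inner_const θ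

theorem integral_inner_eq_zero (hμ : IsIsotropicMeasure μ) (θ : EuclideanSpace ℝ (Fin n)) :
    ∫ x, inner ℝ x θ ∂μ = 0 := by
  simp_rw [real_inner_comm θ]
  rw [integral_inner hμ.integrable_id θ, hμ.barycenter_eq_zero, inner_zero_right]

/-- If this failed, the marginal would have so light a tail that its second moment is less than
`1`. -/
theorem lt_measure_lt_abs_inner (hμ : IsIsotropicMeasure μ) (hlc : IsLogConcaveMeasure μ)
    (hθ : ‖θ‖ = 1) : ENNReal.ofReal (1 / 24) < μ {x | 1 / 5 < |inner ℝ x θ|} := by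
  have := hμ.isProbabilityMeasure
  by_contra! hlight
  set p := (innerₛₗ ℝ θ).toSeminorm
  have hp : ⇑p = fun x => |inner ℝ x θ| := by
    ext x
    rw [real_inner_comm]
    rfl
  have hpm : Measurable p := by rw [hp]; fun_prop
  have htail (r : ℝ) (hr : 1 / 5 ≤ r) :
      μ {x | 3 * r < p x} ≤ ENNReal.ofReal (1 / 23) * μ {x | r < p x} := by
    convert hlc.measure_three_mul_lt_le hpm (r := r) (ε := 1 / 24) (by norm_num) (by norm_num) ?_
      using 3
    · norm_num
    · rw [hp]
      exact (measure_mono fun x hx => hr.trans_lt hx).trans hlight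
  have hmoment := lintegral_sq_le_of_measure_lt_le hpm (apply_nonneg p) three_pos
    ENNReal.ofReal_ne_top htail
  simp only [hp, sq_abs] at hmoment
  rw [hμ.lintegral_inner_sq hθ, mul_one, ← ENNReal.ofReal_add (by norm_num) (by norm_num),
    ← ENNReal.ofReal_mul (by norm_num), ENNReal.one_le_ofReal] at hmoment
  norm_num at hmoment

theorem le_integral_abs_inner (hμ : IsIsotropicMeasure μ) (hlc : IsLogConcaveMeasure μ)
    (hθ : ‖θ‖ = 1) : 1 / 120 ≤ ∫ x, |inner ℝ x θ| ∂μ := by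
  have := hμ.isProbabilityMeasure
  have hmarkov := mul_meas_ge_le_integral_of_nonneg (μ := μ)
    (.of_forall fun x => abs_nonneg (inner ℝ x θ)) (hμ.integrable_inner θ).abs (1 / 5)
  have hmass : 1 / 24 ≤ μ.real {x | 1 / 5 ≤ |inner ℝ x θ|} :=
    (ENNReal.ofReal_le_iff_le_toReal (measure_ne_top _ _)).1 <|
      (hμ.lt_measure_lt_abs_inner hlc hθ).le.trans <|
        measure_mono fun x (hx : 1 / 5 < |inner ℝ x θ|) => hx.le
  linarith

theorem le_integral_inner_posPart (hμ : IsIsotropicMeasure μ) (hlc : IsLogConcaveMeasure μ)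
    (hθ : ‖θ‖ = 1) : 1 / 240 ≤ ∫ x, max (inner ℝ x θ) 0 ∂μ := by
  have hmax (x : EuclideanSpace ℝ (Fin n)) :
      max (inner ℝ x θ) 0 = (inner ℝ x θ + |inner ℝ x θ|) / 2 := by
    rw [max_def]
    split_ifs with h
    · rw [abs_of_nonpos h]; ring
    · rw [abs_of_pos (not_le.1 h)]; ring
  simp_rw [hmax]
  rw [integral_div, integral_add (hμ.integrable_inner θ) (hμ.integrable_inner θ).abs,
    hμ.integral_inner_eq_zero]
  linarith [hμ.le_integral_abs_inner hlc hθ]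

end IsIsotropicMeasure

theorem lt_measure_lt_of_le_integral {α : Type*} [MeasurableSpace α] {ν : Measure α}
    [IsProbabilityMeasure ν] {Y : α → ℝ} (hYm : Measurable Y) (hY : Integrable Y ν)
    (hY2 : Integrable (fun x => Y x ^ 2) ν) (hmean : 1 / 240 ≤ ∫ x, Y x ∂ν)
    (hsecond : ∫ x, Y x ^ 2 ∂ν ≤ 1) : ENNReal.ofReal (1 / 1000000) < ν {x | 1 / 960 < Y x} := by
  have hpz := sq_integral_sub_le_mul_measureReal_lt hYm hY hY2 (a := 1 / 960) (by norm_num)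
    (by linarith) one_pos hsecond
  rw [ENNReal.ofReal_lt_iff_lt_toReal (by norm_num) (measure_ne_top _ _)]
  change 1 / 1000000 < ν.real {x | 1 / 960 < Y x}
  nlinarith

namespace IsIsotropicMeasure

variable {n : ℕ} {μ : Measure (EuclideanSpace ℝ (Fin n))} {θ : EuclideanSpace ℝ (Fin n)}

theorem lt_measure_lt_inner (hμ : IsIsotropicMeasure μ) (hlc : IsLogConcaveMeasure μ)
    (hθ : ‖θ‖ = 1) : ENNReal.ofReal (1 / 1000000) < μ {x | 1 / 960 < inner ℝ x θ} := by
  have := hμ.isProbabilityMeasure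
  have hm : Measurable fun x : EuclideanSpace ℝ (Fin n) => max (inner ℝ x θ) 0 := by fun_prop
  have hle (x : EuclideanSpace ℝ (Fin n)) : max (inner ℝ x θ) 0 ^ 2 ≤ inner ℝ x θ ^ 2 := by
    rw [sq_le_sq, abs_of_nonneg (le_max_right _ _)]
    exact max_le (le_abs_self _) (abs_nonneg _)
  have hint : Integrable (fun x => max (inner ℝ x θ) 0 ^ 2) μ :=
    (hμ.integrable_inner_sq hθ).mono' (hm.pow_const 2).aestronglyMeasurable
      (.of_forall fun x => (Real.norm_of_nonneg (sq_nonneg _)).trans_le (hle x))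
  refine (lt_measure_lt_of_le_integral hm (hμ.integrable_inner θ).pos_part hint
    (hμ.le_integral_inner_posPart hlc hθ) ?_).trans_le (measure_mono fun x hx => ?_)
  · rw [← hμ.second_moment θ hθ]
    exact integral_mono hint (hμ.integrable_inner_sq hθ) hle
  · exact (lt_max_iff.1 (Set.mem_ofPred_eq ▸ hx)).resolve_right (by norm_num)

theorem lt_measure_lt_sum_abs_div (hn : n ≠ 0) (hμ : IsIsotropicMeasure μ)
    (hlc : IsLogConcaveMeasure μ) :
    ENNReal.ofReal (1 / 1000000) < μ {x | 1 / 960 < (∑ i, |x i|) / n} := by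
  have := hμ.isProbabilityMeasure
  have hn0 : (0 : ℝ) < n := by positivity
  have hm : Measurable fun x : EuclideanSpace ℝ (Fin n) => (∑ i, |x i|) / n := by fun_prop
  have hle (x : EuclideanSpace ℝ (Fin n)) : ((∑ i, |x i|) / n) ^ 2 ≤ (∑ i, x i ^ 2) / n := by
    simpa using sum_div_card_sq_le_sum_sq_div_card (s := Finset.univ) (f := fun i => |x i|)
  have habs (i : Fin n) : Integrable (fun x : EuclideanSpace ℝ (Fin n) => |x i|) μ := by
    simpa [EuclideanSpace.inner_single_right] using
      (hμ.integrable_inner (EuclideanSpace.single i 1)).abs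
  have hmean (i : Fin n) : 1 / 120 ≤ ∫ x, |x i| ∂μ := by
    simpa [EuclideanSpace.inner_single_right] using
      hμ.le_integral_abs_inner hlc (θ := EuclideanSpace.single i 1) (by simp)
  have hsq : Integrable (fun x : EuclideanSpace ℝ (Fin n) => (∑ i, x i ^ 2) / n) μ :=
    (integrable_finsetSum _ fun i _ => hμ.integrable_apply_sq i).div_const _
  have hint : Integrable (fun x : EuclideanSpace ℝ (Fin n) => ((∑ i, |x i|) / n) ^ 2) μ :=
    hsq.mono' (hm.pow_const 2).aestronglyMeasurable
      (.of_forall fun x => (Real.norm_of_nonneg (sq_nonneg _)).trans_le (hle x))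
  refine lt_measure_lt_of_le_integral hm
    ((integrable_finsetSum _ fun i _ => habs i).div_const _) hint ?_ ?_
  · rw [integral_div, integral_finsetSum _ fun i _ => habs i, le_div_iff₀ hn0]
    have hsum := Finset.card_nsmul_le_sum Finset.univ _ _ fun i _ => hmean i
    rw [Finset.card_univ, Fintype.card_fin, nsmul_eq_mul] at hsum
    linarith
  · refine (integral_mono hint hsq hle).trans_eq ?_
    rw [integral_div, integral_finsetSum _ fun i _ => hμ.integrable_apply_sq i]
    simp [hμ.integral_apply_sq, hn0.ne']

theorem ball_subset_interior (hμ : IsIsotropicMeasure μ) (hlc : IsLogConcaveMeasure μ)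
    (hac : μ ≪ volume) {D : Set (EuclideanSpace ℝ (Fin n))} (hD : Convex ℝ D)
    (hμD : μ Dᶜ ≤ ENNReal.ofReal (1 / 1000000)) : Metric.ball 0 (1 / 960) ⊆ interior D := by
  have := hμ.isProbabilityMeasure
  have hDμ : μ D ≠ 0 := fun h => by
    have hone : (1 : ℝ≥0∞) ≤ μ D + μ Dᶜ := by
      simpa [Set.union_compl_self] using measure_union_le (μ := μ) D Dᶜ
    rw [h, zero_add] at hone
    have := ENNReal.one_le_ofReal.1 (hone.trans hμD)
    norm_num at this
  rw [← hD.interior_closure_eq_interior_of_nonempty_interior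
    (interior_nonempty_of_convex_of_addHaar_ne_zero volume hD fun h => hDμ (hac h))]
  refine interior_maximal (fun x hx => ?_) Metric.isOpen_ball
  by_contra hxD
  obtain ⟨θ, hθ, hsep⟩ :=
    exists_norm_eq_one_forall_inner_lt hD (nonempty_of_measure_ne_zero hDμ) hxD
  refine (hμ.lt_measure_lt_inner hlc hθ).not_ge ((measure_mono fun z hz hzD => ?_).trans hμD)
  have hxθ : inner ℝ x θ ≤ ‖x‖ := by simpa [hθ] using real_inner_le_norm x θ
  have hz' : 1 / 960 < inner ℝ z θ := hz
  linarith [hsep z hzD, mem_ball_zero_iff.1 hx]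

end IsIsotropicMeasure

/-! ### Borell's theorem: isotropic log-concave measures have log-concave densities -/

/-- The lower density of `ν` with respect to `volume`. Unlike the Radon–Nikodym derivative it is
defined at every point, and it records the singular part of `ν` as the value `∞`. -/
noncomputable def lowerDensity {E : Type*} [PseudoMetricSpace E] [MeasureSpace E] (ν : Measure E)
    (x : E) : ℝ≥0∞ :=
  liminf (fun r : ℝ => ν (Metric.closedBall x r) / volume (Metric.closedBall x r)) (𝓝[>] 0)

section LowerDensity

variable {E : Type*} [MetricSpace E] [SecondCountableTopology E] [HasBesicovitchCovering E]
  [MeasureSpace E] [BorelSpace E] [IsLocallyFiniteMeasure (volume : Measure E)] (ν : Measure E)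

theorem lowerDensity_ae_eq_rnDeriv [IsLocallyFiniteMeasure ν] :
    lowerDensity ν =ᵐ[volume] ν.rnDeriv volume := by
  filter_upwards [Besicovitch.ae_tendsto_rnDeriv ν volume] with x hx
  exact hx.liminf_eq

theorem lowerDensity_ae_eq_top_singularPart [IsFiniteMeasure ν] [ProperSpace E]
    [(volume : Measure E).IsOpenPosMeasure] :
    ∀ᵐ x ∂(ν.singularPart volume), lowerDensity ν x = ∞ := by
  have hsing : (volume : Measure E) ⟂ₘ ν.singularPart volume :=
    (Measure.mutuallySingular_singularPart ν volume).symm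
  filter_upwards [Besicovitch.ae_tendsto_rnDeriv volume (ν.singularPart volume),
    hsing.rnDeriv_ae_eq_zero] with x hlim hzero
  rw [hzero, Pi.zero_apply] at hlim
  have htop := tendsto_inv_iff.2 hlim
  rw [ENNReal.inv_zero] at htop
  rw [← top_le_iff, ← htop.liminf_eq]
  refine liminf_le_liminf ?_
  filter_upwards [self_mem_nhdsWithin] with r hr
  rw [ENNReal.inv_div (.inr measure_closedBall_lt_top.ne)
    (.inr (Metric.measure_closedBall_pos volume x hr).ne')]
  gcongr
  exact Measure.singularPart_le ν volume

end LowerDensity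

theorem smul_closedBall_add_smul_closedBall_subset {E : Type*} [SeminormedAddCommGroup E]
    [NormedSpace ℝ E] (x y : E) (r : ℝ) {l : ℝ} (h0 : 0 ≤ l) (h1 : l ≤ 1) :
    l • Metric.closedBall x r + (1 - l) • Metric.closedBall y r ⊆
      Metric.closedBall (l • x + (1 - l) • y) r := by
  rintro _ ⟨_, ⟨a, ha, rfl⟩, _, ⟨b, hb, rfl⟩, rfl⟩
  rw [Metric.mem_closedBall] at *
  calc dist (l • a + (1 - l) • b) (l • x + (1 - l) • y)
      ≤ dist (l • a) (l • x) + dist ((1 - l) • b) ((1 - l) • y) := dist_add_add_le _ _ _ _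
    _ = l * dist a x + (1 - l) * dist b y := by
        rw [dist_smul₀, dist_smul₀, Real.norm_of_nonneg h0, Real.norm_of_nonneg (sub_nonneg.2 h1)]
    _ ≤ l * r + (1 - l) * r := by
        have := sub_nonneg.2 h1
        gcongr
    _ = r := by ring

namespace IsLogConcaveMeasure

variable {n : ℕ} {μ : Measure (EuclideanSpace ℝ (Fin n))}

theorem lowerDensity_rpow_mul_le (hlc : IsLogConcaveMeasure μ) (x y : EuclideanSpace ℝ (Fin n))
    {l : ℝ} (h0 : 0 < l) (h1 : l < 1) :
    lowerDensity μ x ^ l * lowerDensity μ y ^ (1 - l) ≤ lowerDensity μ (l • x + (1 - l) • y) := by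
  have hpow (z : EuclideanSpace ℝ (Fin n)) {p : ℝ} (hp : 0 < p) : lowerDensity μ z ^ p =
      liminf (fun r : ℝ => (μ (Metric.closedBall z r) / volume (Metric.closedBall z r)) ^ p)
        (𝓝[>] 0) :=
    (ENNReal.monotone_rpow_of_nonneg hp.le).map_liminf_of_continuousAt _
      ENNReal.continuous_rpow_const.continuousAt
  rw [hpow x h0, hpow y (sub_pos.2 h1)]
  refine ENNReal.le_liminf_mul.trans (liminf_le_liminf ?_)
  filter_upwards [self_mem_nhdsWithin] with r hr
  have hvol (z : EuclideanSpace ℝ (Fin n)) :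
      volume (Metric.closedBall z r) =
        volume (Metric.closedBall (0 : EuclideanSpace ℝ (Fin n)) r) :=
    Measure.addHaar_closedBall_center _ z r
  set v := volume (Metric.closedBall (0 : EuclideanSpace ℝ (Fin n)) r)
  have hv0 : v ≠ 0 := (Metric.measure_closedBall_pos volume _ hr).ne'
  have hvtop : v ≠ ∞ := measure_closedBall_lt_top.ne
  have hv : v ^ l * v ^ (1 - l) = v := by
    rw [← ENNReal.rpow_add _ _ hv0 hvtop, add_sub_cancel, ENNReal.rpow_one]
  have hball := (hlc _ _ measurableSet_closedBall measurableSet_closedBall l h0 h1).trans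
    (measure_mono (smul_closedBall_add_smul_closedBall_subset x y r h0.le h1.le))
  rw [Pi.mul_apply, hvol x, hvol y, hvol (l • x + (1 - l) • y),
    ENNReal.div_rpow_of_nonneg _ _ h0.le, ENNReal.div_rpow_of_nonneg _ _ (sub_pos.2 h1).le,
    ENNReal.div_eq_inv_mul, ENNReal.div_eq_inv_mul, ENNReal.div_eq_inv_mul, mul_mul_mul_comm,
    ← ENNReal.mul_inv (.inr (by simp [ENNReal.rpow_eq_top_iff, hvtop, hv0]))
      (.inl (by simp [ENNReal.rpow_eq_top_iff, hvtop, hv0])), hv]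
  gcongr

theorem convex_setOf_lowerDensity_eq_top (hlc : IsLogConcaveMeasure μ) :
    Convex ℝ {x | lowerDensity μ x = ∞} := by
  rw [convex_iff_forall_pos]
  intro x (hx : lowerDensity μ x = ∞) y (hy : lowerDensity μ y = ∞) a b ha hb hab
  obtain rfl : b = 1 - a := by linarith
  have hle := hlc.lowerDensity_rpow_mul_le x y ha (sub_pos.1 hb)
  rwa [hx, hy, ENNReal.top_rpow_of_pos ha, ENNReal.top_rpow_of_pos hb, ENNReal.top_mul_top,
    top_le_iff] at hle

/-- The homothety with center `x₀` and ratio `1 / 2` maps the set where the lower density is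
positive into the null set where it is infinite. -/
theorem lowerDensity_ae_eq_zero [IsLocallyFiniteMeasure μ] (hlc : IsLogConcaveMeasure μ)
    {x₀ : EuclideanSpace ℝ (Fin n)} (hx₀ : lowerDensity μ x₀ = ∞) :
    lowerDensity μ =ᵐ[volume] 0 := by
  have hfinite : ∀ᵐ x, lowerDensity μ x ≠ ∞ := by
    filter_upwards [lowerDensity_ae_eq_rnDeriv μ, Measure.rnDeriv_ne_top μ volume] with x hx hx'
    rwa [hx]
  have hsub : AffineMap.homothety x₀ (1 / 2 : ℝ) '' {x | ¬lowerDensity μ x = 0} ⊆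
      {x | ¬lowerDensity μ x ≠ ∞} := by
    rintro _ ⟨x, hx, rfl⟩
    have hmid : AffineMap.homothety x₀ (1 / 2 : ℝ) x =
        (1 / 2 : ℝ) • x₀ + (1 - 1 / 2 : ℝ) • x := by
      rw [AffineMap.homothety_apply, vsub_eq_sub, vadd_eq_add]
      module
    have hle := hlc.lowerDensity_rpow_mul_le x₀ x (l := 1 / 2) (by norm_num) (by norm_num)
    have hpos : lowerDensity μ x ^ (1 - 1 / 2 : ℝ) ≠ 0 := by
      rw [Ne, ENNReal.rpow_eq_zero_iff_of_pos (by norm_num)]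
      exact hx
    rw [hx₀, ENNReal.top_rpow_of_pos (by norm_num), ENNReal.top_mul hpos, top_le_iff,
      ← hmid] at hle
    exact not_not.2 hle
  have hnull := measure_mono_null hsub hfinite
  rw [Measure.addHaar_image_homothety] at hnull
  exact (mul_eq_zero.1 hnull).resolve_left (by simp)

theorem eq_singularPart_of_lowerDensity_eq_top [IsFiniteMeasure μ] (hlc : IsLogConcaveMeasure μ)
    {x₀ : EuclideanSpace ℝ (Fin n)} (hx₀ : lowerDensity μ x₀ = ∞) :
    μ = μ.singularPart volume := by
  have hzero : volume.withDensity (μ.rnDeriv volume) = 0 := by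
    rw [withDensity_eq_zero_iff (Measure.measurable_rnDeriv _ _).aemeasurable]
    exact (lowerDensity_ae_eq_rnDeriv μ).symm.trans (hlc.lowerDensity_ae_eq_zero hx₀)
  conv_lhs => rw [Measure.haveLebesgueDecomposition_add μ volume, hzero, add_zero]

end IsLogConcaveMeasure

theorem exists_norm_eq_one_forall_inner_eq_of_addHaar_eq_zero {E : Type*} [NormedAddCommGroup E]
    [InnerProductSpace ℝ E] [FiniteDimensional ℝ E] [MeasurableSpace E] [BorelSpace E]
    (μ : Measure E) [μ.IsAddHaarMeasure] {Z : Set E} (hZ : Convex ℝ Z) (hμZ : μ Z = 0) {z : E}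
    (hz : z ∈ Z) : ∃ θ : E, ‖θ‖ = 1 ∧ ∀ x ∈ Z, inner ℝ x θ = inner ℝ z θ := by
  have hdir : (affineSpan ℝ Z).direction ≠ ⊤ := fun h => by
    have hspan := (AffineSubspace.direction_eq_top_iff_of_nonempty
      ⟨z, subset_affineSpan ℝ Z hz⟩).1 h
    exact (Measure.measure_pos_of_nonempty_interior μ
      (hZ.interior_nonempty_iff_affineSpan_eq_top.2 hspan)).ne' hμZ
  obtain ⟨v, hv, hv0⟩ := Submodule.exists_mem_ne_zero_of_ne_bot
    (mt Submodule.orthogonal_eq_bot_iff.1 hdir)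
  refine ⟨‖v‖⁻¹ • v, norm_smul_inv_norm hv0, fun x hx => ?_⟩
  have horth := (Submodule.mem_orthogonal _ _).1 hv _ (AffineSubspace.vsub_mem_direction
    (subset_affineSpan ℝ Z hx) (subset_affineSpan ℝ Z hz))
  rw [vsub_eq_sub, inner_sub_left, sub_eq_zero] at horth
  rw [real_inner_smul_right, real_inner_smul_right, horth]

namespace IsIsotropicMeasure

variable {n : ℕ} {μ : Measure (EuclideanSpace ℝ (Fin n))}

theorem not_ae_inner_eq (hμ : IsIsotropicMeasure μ) {θ : EuclideanSpace ℝ (Fin n)} (hθ : ‖θ‖ = 1)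
    (c : ℝ) : ¬∀ᵐ x ∂μ, inner ℝ x θ = c := by
  intro hconst
  have := hμ.isProbabilityMeasure
  have hc : c = 0 := by
    simpa [hμ.integral_inner_eq_zero θ] using (integral_congr_ae hconst).symm
  have hsq : ∀ᵐ x ∂μ, inner ℝ x θ ^ 2 = (0 : ℝ) := by
    filter_upwards [hconst] with x hx
    rw [hx, hc, sq, zero_mul]
  simpa [hμ.second_moment θ hθ] using integral_congr_ae hsq

theorem not_ae_mem_of_convex_null (hμ : IsIsotropicMeasure μ)
    {Z : Set (EuclideanSpace ℝ (Fin n))} (hZ : Convex ℝ Z) (hvol : volume Z = 0) :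
    ¬∀ᵐ x ∂μ, x ∈ Z := by
  intro hae
  have := hμ.isProbabilityMeasure
  obtain ⟨z, hz⟩ : Z.Nonempty := hae.exists
  obtain ⟨θ, hθ, hconst⟩ := exists_norm_eq_one_forall_inner_eq_of_addHaar_eq_zero volume hZ hvol hz
  exact hμ.not_ae_inner_eq hθ _ (hae.mono hconst)

theorem lowerDensity_ne_top (hμ : IsIsotropicMeasure μ) (hlc : IsLogConcaveMeasure μ)
    (x : EuclideanSpace ℝ (Fin n)) : lowerDensity μ x ≠ ∞ := by
  intro hx
  have := hμ.isProbabilityMeasure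
  have hae := lowerDensity_ae_eq_top_singularPart μ
  rw [← hlc.eq_singularPart_of_lowerDensity_eq_top hx] at hae
  refine hμ.not_ae_mem_of_convex_null hlc.convex_setOf_lowerDensity_eq_top
    (measure_mono_null (fun y (hy : lowerDensity μ y = ∞) => ?_) (hlc.lowerDensity_ae_eq_zero hx))
    hae
  simp [hy]

theorem isLogConcaveDensity_lowerDensity (hμ : IsIsotropicMeasure μ)
    (hlc : IsLogConcaveMeasure μ) :
    IsLogConcaveDensity (fun x => (lowerDensity μ x).toReal) μ := by
  have := hμ.isProbabilityMeasure
  have hfin := hμ.lowerDensity_ne_top hlc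
  refine ⟨fun x => ENNReal.toReal_nonneg, fun x y l h0 h1 => ?_, ?_⟩
  · rcases h0.eq_or_lt with rfl | h0
    · simp
    rcases h1.eq_or_lt with rfl | h1
    · simp
    rw [ENNReal.toReal_rpow, ENNReal.toReal_rpow, ← ENNReal.toReal_mul]
    exact ENNReal.toReal_mono (hfin _) (hlc.lowerDensity_rpow_mul_le x y h0 h1)
  · have hsing : μ.singularPart volume = 0 := by
      by_contra hne
      have : (ae (μ.singularPart volume)).NeBot := ae_neBot.2 hne
      obtain ⟨x, hx⟩ := (lowerDensity_ae_eq_top_singularPart μ).exists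
      exact hfin x hx
    conv_lhs => rw [Measure.haveLebesgueDecomposition_add μ volume, hsing, zero_add]
    refine withDensity_congr_ae ?_
    filter_upwards [lowerDensity_ae_eq_rnDeriv μ] with x hx
    rw [ENNReal.ofReal_toReal (hfin x), hx]

end IsIsotropicMeasure

/-! ### Level sets with a large inscribed ball -/

namespace IsLogConcaveDensity

variable {n : ℕ} {f g : EuclideanSpace ℝ (Fin n) → ℝ} {μ : Measure (EuclideanSpace ℝ (Fin n))}
  {t : ℝ}

theorem levelSet_ae_eq [IsProbabilityMeasure μ] (hf : IsLogConcaveDensity f μ)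
    (hg : IsLogConcaveDensity g μ) (t : ℝ) : levelSet f t =ᵐ[volume] levelSet g t := by
  filter_upwards [hf.ae_eq hg] with x hx
  exact congrArg (t ≤ ·) hx

theorem interior_levelSet_ae_eq (hf : IsLogConcaveDensity f μ) (ht : 0 < t) :
    interior (levelSet f t) =ᵐ[volume] levelSet f t :=
  interior_ae_eq_of_null_frontier ((hf.convex_levelSet ht).addHaar_frontier volume)

theorem interior_levelSet_eq [IsProbabilityMeasure μ] (hf : IsLogConcaveDensity f μ)
    (hg : IsLogConcaveDensity g μ) (ht : 0 < t) :
    interior (levelSet f t) = interior (levelSet g t) :=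
  (interior_subset_interior_of_convex_of_addHaar_diff_eq_zero volume (hg.convex_levelSet ht)
    (ae_le_set.1 (hf.levelSet_ae_eq hg t).le)).antisymm
  (interior_subset_interior_of_convex_of_addHaar_diff_eq_zero volume (hf.convex_levelSet ht)
    (ae_le_set.1 (hg.levelSet_ae_eq hf t).le))

theorem comp_linearIsometryEquiv (hf : IsLogConcaveDensity f μ)
    {T : EuclideanSpace ℝ (Fin n) ≃ₗᵢ[ℝ] EuclideanSpace ℝ (Fin n)} (hT : μ.map T = μ) :
    IsLogConcaveDensity (f ∘ T) μ where
  nonneg x := hf.nonneg _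
  logConcave x y l h0 h1 := by simpa using hf.logConcave (T x) (T y) l h0 h1
  eq_withDensity := by
    have hTe : MeasurableEmbedding T := T.toHomeomorph.measurableEmbedding
    ext S hS
    calc μ S = μ (T '' S) := by
          conv_rhs => rw [← hT, hTe.map_apply, Set.preimage_image_eq _ T.injective]
      _ = ∫⁻ x in T '' S, ENNReal.ofReal (f x) := hf.apply_eq _
      _ = ∫⁻ x in S, ENNReal.ofReal (f (T x)) :=
          (T.measurePreserving.setLIntegral_comp_emb hTe _ S).symm
      _ = _ := (withDensity_apply _ hS).symm

theorem map_mem_interior_levelSet [IsProbabilityMeasure μ] (hf : IsLogConcaveDensity f μ)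
    (ht : 0 < t) {T : EuclideanSpace ℝ (Fin n) ≃ₗᵢ[ℝ] EuclideanSpace ℝ (Fin n)}
    (hT : μ.map T = μ) {x : EuclideanSpace ℝ (Fin n)} (hx : x ∈ interior (levelSet f t)) :
    T x ∈ interior (levelSet f t) := by
  rw [hf.interior_levelSet_eq (hf.comp_linearIsometryEquiv hT) ht] at hx
  change x ∈ T.toHomeomorph ⁻¹' interior (levelSet f t)
  rw [T.toHomeomorph.preimage_interior]
  exact hx

end IsLogConcaveDensity

section SignedPerm

variable {n : ℕ} {D : Set (EuclideanSpace ℝ (Fin n))} {x : EuclideanSpace ℝ (Fin n)}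

/-- The linear isometry that permutes the coordinates by `σ` and changes their signs by `s`, in
the form used by `IsOneSymmetric`. -/
noncomputable def signedPerm (σ : Equiv.Perm (Fin n)) (s : Fin n → ℤˣ) :
    EuclideanSpace ℝ (Fin n) ≃ₗᵢ[ℝ] EuclideanSpace ℝ (Fin n) :=
  LinearIsometry.toLinearIsometryEquiv
    { toFun := fun x => WithLp.toLp 2 (fun i => ((s i : ℤ) : ℝ) * x (σ i))
      map_add' := fun x y => by ext i; simp [mul_add]
      map_smul' := fun c x => by ext i; simp; ring
      norm_map' := fun x => by
        have hsq (i : Fin n) : (((s i : ℤ) : ℝ) * x (σ i)) ^ 2 = x (σ i) ^ 2 := by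
          rcases Int.units_eq_one_or (s i) with h | h <;> simp [h]
        rw [← sq_eq_sq₀ (norm_nonneg _) (norm_nonneg _), EuclideanSpace.real_norm_sq_eq,
          EuclideanSpace.real_norm_sq_eq]
        simp only [LinearMap.coe_mk, AddHom.coe_mk, hsq]
        exact Equiv.sum_comp σ (fun i => x i ^ 2) } rfl

theorem signedPerm_apply (σ : Equiv.Perm (Fin n)) (s : Fin n → ℤˣ) (x : EuclideanSpace ℝ (Fin n))
    (i : Fin n) : signedPerm σ s x i = ((s i : ℤ) : ℝ) * x (σ i) := rfl

/-- The cube `[-a, a]^n`. -/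
def euclideanCube (n : ℕ) (a : ℝ) : Set (EuclideanSpace ℝ (Fin n)) := {x | ∀ i, |x i| ≤ a}

theorem euclideanCube_subset_euclideanCube (n : ℕ) {a b : ℝ} (h : a ≤ b) :
    euclideanCube n a ⊆ euclideanCube n b := fun _ hx i => (hx i).trans h

theorem closedBall_subset_euclideanCube (n : ℕ) (a : ℝ) :
    Metric.closedBall 0 a ⊆ euclideanCube n a := fun x hx i =>
  (PiLp.norm_apply_le x i).trans (mem_closedBall_zero_iff.1 hx)

theorem euclideanCube_eq_preimage (n : ℕ) (a : ℝ) :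
    euclideanCube n a = (MeasurableEquiv.toLp 2 (Fin n → ℝ)).symm ⁻¹'
      (Set.univ.pi fun _ => Set.Icc (-a) a) := by
  ext x
  simp [euclideanCube, abs_le, Pi.le_def, forall_and]

theorem measurableSet_euclideanCube (n : ℕ) (a : ℝ) : MeasurableSet (euclideanCube n a) := by
  rw [euclideanCube_eq_preimage]
  exact (MeasurableEquiv.measurable _) (MeasurableSet.univ_pi fun _ => measurableSet_Icc)

theorem volume_euclideanCube (n : ℕ) (a : ℝ) :
    volume (euclideanCube n a) = ENNReal.ofReal (2 * a) ^ n := by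
  rw [euclideanCube_eq_preimage,
    (EuclideanSpace.volume_preserving_symm_measurableEquiv_toLp (Fin n)).measure_preimage
      (MeasurableSet.univ_pi fun _ => measurableSet_Icc).nullMeasurableSet, volume_pi_pi]
  simp [two_mul]

theorem convex_euclideanCube (n : ℕ) (a : ℝ) : Convex ℝ (euclideanCube n a) := by
  rw [euclideanCube_eq_preimage]
  exact (convex_pi fun _ _ => convex_Icc _ _).linear_preimage
    (WithLp.linearEquiv 2 ℝ (Fin n → ℝ)).toLinearMap

theorem toLp_abs_mem_of_signedPerm_mem (hsym : ∀ σ s, ∀ y ∈ D, signedPerm σ s y ∈ D)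
    (hx : x ∈ D) : WithLp.toLp 2 (fun i => |x i|) ∈ D := by
  convert hsym 1 (fun i => if 0 ≤ x i then 1 else -1) x hx using 1
  ext i
  rw [signedPerm_apply]
  split_ifs with h
  · simp [abs_of_nonneg h]
  · simp [abs_of_neg (not_le.1 h)]

/-- The mean of a vector over the cyclic shifts of its coordinates has constant coordinates. -/
theorem toLp_const_mem_of_signedPerm_mem (hn : n ≠ 0) (hD : Convex ℝ D)
    (hsym : ∀ σ s, ∀ y ∈ D, signedPerm σ s y ∈ D) (hx : x ∈ D) :
    WithLp.toLp 2 (fun _ => (∑ i, |x i|) / n) ∈ D := by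
  have : NeZero n := ⟨hn⟩
  have hmean := hD.sum_mem (t := Finset.univ) (w := fun _ : Fin n => (n : ℝ)⁻¹)
    (z := fun j => signedPerm (Equiv.addRight j) 1 (WithLp.toLp 2 fun i => |x i|))
    (fun i _ => by positivity) (by simp [hn])
    (fun j _ => hsym _ _ _ (toLp_abs_mem_of_signedPerm_mem hsym hx))
  convert hmean using 1
  ext i
  rw [← Finset.smul_sum, PiLp.smul_apply, WithLp.ofLp_sum, Finset.sum_apply, smul_eq_mul,
    ← div_eq_inv_mul]
  simp only [signedPerm_apply, Pi.one_apply, Units.val_one, Int.cast_one, one_mul,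
    Equiv.coe_addRight]
  rw [← Equiv.sum_comp (Equiv.addLeft i) fun j => |x j|]
  rfl

theorem euclideanCube_subset_of_toLp_const_mem (hD : Convex ℝ D)
    (hsym : ∀ σ s, ∀ y ∈ D, signedPerm σ s y ∈ D) {a : ℝ}
    (ha : WithLp.toLp 2 (fun _ => a) ∈ D) : euclideanCube n a ⊆ D := by
  have hvertices : Set.univ.pi (fun _ : Fin n => ({-a, a} : Set ℝ)) ⊆
      {y | WithLp.toLp 2 y ∈ D} := by
    intro y hy
    have hflip := hsym 1 (fun i => if y i = a then 1 else -1) _ ha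
    rw [Set.mem_ofPred_eq]
    convert hflip using 1
    ext i
    rw [signedPerm_apply]
    split_ifs with h
    · simp [h]
    · simp [(hy i (Set.mem_univ i)).resolve_right h]
  have hhull := convexHull_min hvertices
    (hD.linear_preimage (WithLp.linearEquiv 2 ℝ (Fin n → ℝ)).symm.toLinearMap)
  rw [convexHull_pi] at hhull
  refine fun z hz => hhull (a := z.ofLp) fun i _ => ?_
  rw [convexHull_pair, segment_eq_Icc (neg_le_self ((abs_nonneg _).trans (hz i)))]
  exact abs_le.1 (hz i)

theorem euclideanCube_subset_of_signedPerm_mem (hn : n ≠ 0) (hD : Convex ℝ D)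
    (hsym : ∀ σ s, ∀ y ∈ D, signedPerm σ s y ∈ D) (hx : x ∈ D) :
    euclideanCube n ((∑ i, |x i|) / n) ⊆ D :=
  euclideanCube_subset_of_toLp_const_mem hD hsym (toLp_const_mem_of_signedPerm_mem hn hD hsym hx)

end SignedPerm

theorem volume_sum_abs_div_le {n : ℕ} (hn : n ≠ 0) {a : ℝ} (ha : 0 ≤ a) :
    volume {x : EuclideanSpace ℝ (Fin n) | (∑ i, |x i|) / n ≤ a} ≤
      ENNReal.ofReal ((2 * Real.exp 1 * a) ^ n) := by
  have hn0 : (0 : ℝ) < n := by positivity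
  have : NeZero n := ⟨hn⟩
  have hpre : {x : EuclideanSpace ℝ (Fin n) | (∑ i, |x i|) / n ≤ a} =
      (MeasurableEquiv.toLp 2 (Fin n → ℝ)).symm ⁻¹'
        {x : Fin n → ℝ | (∑ i, |x i| ^ (1 : ℝ)) ^ (1 / (1 : ℝ)) ≤ n * a} := by
    ext x
    simp [div_le_iff₀' hn0]
  have hmeas : MeasurableSet {x : Fin n → ℝ | (∑ i, |x i| ^ (1 : ℝ)) ^ (1 / (1 : ℝ)) ≤ n * a} :=
    measurableSet_le (by fun_prop) measurable_const
  have hGamma : Real.Gamma (1 / 1 + 1) = 1 := by norm_num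
  rw [hpre, (EuclideanSpace.volume_preserving_symm_measurableEquiv_toLp (Fin n)).measure_preimage
    hmeas.nullMeasurableSet, volume_sum_rpow_le _ le_rfl, Fintype.card_fin,
    ← ENNReal.ofReal_pow (by positivity), ← ENNReal.ofReal_mul (by positivity), hGamma, div_one,
    Real.Gamma_nat_eq_factorial, mul_one]
  refine ENNReal.ofReal_le_ofReal ?_
  calc ((n : ℝ) * a) ^ n * (2 ^ n / n.factorial)
      = (n : ℝ) ^ n / n.factorial * (2 * a) ^ n := by rw [mul_pow, mul_pow]; ring
    _ ≤ Real.exp n * (2 * a) ^ n := by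
      gcongr
      exact Real.pow_div_factorial_le_exp n hn0.le n
    _ = (2 * Real.exp 1 * a) ^ n := by
      rw [← mul_one (n : ℝ), Real.exp_nat_mul, ← mul_pow]
      ring

theorem lt_of_ofReal_lt_eLpNorm_top {α : Type*} [MeasurableSpace α] {ν : Measure α} {f : α → ℝ}
    {t c : ℝ} (hf : ∀ x, |f x| ≤ c) (ht : ENNReal.ofReal t < eLpNorm f ∞ ν) : t < c := by
  by_contra! hct
  refine ht.not_ge (le_trans ?_ (ENNReal.ofReal_le_ofReal hct))
  rw [eLpNorm_exponent_top]
  exact eLpNormEssSup_le_of_ae_bound (.of_forall hf)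

section Dilates

variable {E : Type*} [NormedAddCommGroup E] [NormedSpace ℝ E]

theorem singleton_add_smul_eq_singleton_add_smul {r₁ : ℝ} (hr₁ : r₁ ≠ 0) (r₀ : ℝ) (y₀ y₁ : E)
    (K : Set E) :
    {y₀} + r₀ • K = {y₀ - (r₀ / r₁) • y₁} + (r₀ / r₁) • ({y₁} + r₁ • K) := by
  rw [smul_add, Set.smul_set_singleton, smul_smul, div_mul_cancel₀ _ hr₁, ← add_assoc,
    Set.singleton_add_singleton, sub_add_cancel]

theorem ball_subset_singleton_add_smul {L : Set E} {ρ r : ℝ} (hr : 0 < r)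
    (hL : Metric.ball 0 ρ ⊆ L) (y : E) : Metric.ball y (r * ρ) ⊆ {y} + r • L := by
  refine subset_trans ?_ (Set.add_subset_add_left (Set.smul_set_mono hL))
  rw [smul_ball hr.ne', singleton_add_ball, smul_zero, add_zero, Real.norm_of_nonneg hr.le]

variable [MeasurableSpace E] [BorelSpace E] [FiniteDimensional ℝ E] (μ : Measure E)
  [μ.IsAddHaarMeasure]

theorem addHaar_singleton_add_smul {r : ℝ} (hr : 0 ≤ r) (y : E) (K : Set E) :
    μ ({y} + r • K) = ENNReal.ofReal (r ^ Module.finrank ℝ E) * μ K := by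
  rw [Set.singleton_add, Set.image_add_left, measure_preimage_add, Measure.addHaar_smul,
    abs_of_nonneg (by positivity)]

theorem one_le_mul_of_addHaar_le_mul_addHaar_dilate [Nontrivial E] {L : Set E} (hL₀ : μ L ≠ 0)
    (hL : μ L ≠ ∞) {B r : ℝ} (hB : 0 ≤ B) (hr : 0 ≤ r) {y : E}
    (h : μ L ≤ ENNReal.ofReal (B ^ Module.finrank ℝ E) * μ ({y} + r • L)) : 1 ≤ B * r := by
  rw [addHaar_singleton_add_smul μ hr, ← mul_assoc, ← ENNReal.ofReal_mul (by positivity),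
    ← mul_pow] at h
  have hpow : (1 : ℝ≥0∞) ≤ ENNReal.ofReal ((B * r) ^ Module.finrank ℝ E) := by
    rwa [← ENNReal.mul_le_mul_iff_left hL₀ hL, one_mul]
  rwa [ENNReal.one_le_ofReal, one_le_pow_iff_of_nonneg (by positivity)
    Module.finrank_pos.ne'] at hpow

end Dilates

section Classes

variable {n : ℕ} {f : EuclideanSpace ℝ (Fin n) → ℝ} {μ : Measure (EuclideanSpace ℝ (Fin n))}

theorem isLogConcaveDensity_indicator_interior {K : Set (EuclideanSpace ℝ (Fin n))}
    (hK : Convex ℝ K) (hK₀ : volume K ≠ 0) :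
    IsLogConcaveDensity ((interior K).indicator fun _ => (volume K)⁻¹.toReal)
      ((volume K)⁻¹ • volume.restrict K) := by
  have hnonneg (x) : 0 ≤ (interior K).indicator (fun _ => (volume K)⁻¹.toReal) x :=
    Set.indicator_nonneg (fun _ _ => ENNReal.toReal_nonneg) x
  refine ⟨hnonneg, fun x y l h0 h1 => ?_, ?_⟩
  · rcases h0.eq_or_lt with rfl | h0
    · simp
    rcases h1.eq_or_lt with rfl | h1
    · simp
    have h1' := sub_pos.2 h1
    by_cases hx : x ∈ interior K
    · by_cases hy : y ∈ interior K
      · rw [Set.indicator_of_mem hx, Set.indicator_of_mem hy,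
          Set.indicator_of_mem (hK.interior hx hy h0.le h1'.le (add_sub_cancel l 1)),
          ← Real.rpow_add_of_nonneg ENNReal.toReal_nonneg h0.le h1'.le, add_sub_cancel,
          Real.rpow_one]
      · rw [Set.indicator_of_notMem hy, Real.zero_rpow h1'.ne', mul_zero]
        exact hnonneg _
    · rw [Set.indicator_of_notMem hx, Real.zero_rpow h0.ne', zero_mul]
      exact hnonneg _
  · have hdensity : (fun x => ENNReal.ofReal
        ((interior K).indicator (fun _ => (volume K)⁻¹.toReal) x)) =
        (interior K).indicator fun _ => (volume K)⁻¹ := by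
      ext x
      by_cases hx : x ∈ interior K
      · rw [Set.indicator_of_mem hx, Set.indicator_of_mem hx,
          ENNReal.ofReal_toReal (ENNReal.inv_ne_top.2 hK₀)]
      · rw [Set.indicator_of_notMem hx, Set.indicator_of_notMem hx, ENNReal.ofReal_zero]
    rw [hdensity, withDensity_indicator isOpen_interior.measurableSet, withDensity_const,
      Measure.restrict_congr_set
        (interior_ae_eq_of_null_frontier (hK.addHaar_frontier volume))]

theorem IsUniformOnConvex.hasHomogeneousLevelSets (hu : IsUniformOnConvex μ) :
    HasHomogeneousLevelSets μ := by
  obtain ⟨K, hK, hK₀, -, rfl⟩ := hu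
  refine ⟨_, isLogConcaveDensity_indicator_interior hK hK₀, interior K, fun t ht hlt => ?_⟩
  have htK : t < (volume K)⁻¹.toReal := by
    refine lt_of_ofReal_lt_eLpNorm_top (fun x => ?_) hlt
    rw [abs_of_nonneg (Set.indicator_nonneg (fun _ _ => ENNReal.toReal_nonneg) x)]
    exact Set.indicator_le_self' (fun _ _ => ENNReal.toReal_nonneg) x
  refine ⟨1, one_pos, 0, ?_⟩
  rw [one_smul, Set.singleton_zero, zero_add]
  ext x
  by_cases hx : x ∈ interior K
  · simpa only [levelSet, Set.mem_ofPred_eq, Set.indicator_of_mem hx, hx, iff_true] using htK.le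
  · simpa only [levelSet, Set.mem_ofPred_eq, Set.indicator_of_notMem hx, hx, iff_false, not_le]

theorem isLogConcaveDensity_const_mul_exp_neg {p : Seminorm ℝ (EuclideanSpace ℝ (Fin n))} {c : ℝ}
    (hc : 0 < c) (hμ : μ = volume.withDensity fun x => ENNReal.ofReal (c * Real.exp (-p x))) :
    IsLogConcaveDensity (fun x => c * Real.exp (-p x)) μ := by
  refine ⟨fun x => by positivity, fun x y l h0 h1 => ?_, hμ⟩
  have hp : p (l • x + (1 - l) • y) ≤ l * p x + (1 - l) * p y := by
    simpa only [smul_eq_mul] using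
      p.convexOn.2 (Set.mem_univ x) (Set.mem_univ y) h0 (sub_nonneg.2 h1) (add_sub_cancel l 1)
  rw [Real.mul_rpow hc.le (Real.exp_nonneg _), Real.mul_rpow hc.le (Real.exp_nonneg _),
    ← Real.exp_mul, ← Real.exp_mul, mul_mul_mul_comm, ← Real.rpow_add hc, add_sub_cancel,
    Real.rpow_one, ← Real.exp_add]
  gcongr
  linarith

theorem levelSet_const_mul_exp_neg (p : Seminorm ℝ (EuclideanSpace ℝ (Fin n))) {c t : ℝ}
    (ht : 0 < t) (htc : t < c) :
    levelSet (fun x => c * Real.exp (-p x)) t = Real.log (c / t) • {x | p x ≤ 1} := by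
  have hc : 0 < c := ht.trans htc
  have hr : 0 < Real.log (c / t) := Real.log_pos ((one_lt_div ht).2 htc)
  ext x
  rw [Set.mem_smul_set_iff_inv_smul_mem₀ hr.ne']
  simp only [levelSet, Set.mem_ofPred_eq]
  rw [map_smul_eq_mul, norm_inv, Real.norm_of_nonneg hr.le, inv_mul_le_iff₀ hr, mul_one,
    Real.le_log_iff_exp_le (by positivity), le_div_iff₀ ht, Real.exp_neg, ← div_eq_mul_inv,
    le_div_iff₀ (Real.exp_pos _), mul_comm]

theorem HasExpNormDensity.hasHomogeneousLevelSets (h : HasExpNormDensity μ) :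
    HasHomogeneousLevelSets μ := by
  obtain ⟨p, c, -, hc, hμ⟩ := h
  refine ⟨_, isLogConcaveDensity_const_mul_exp_neg hc hμ, {x | p x ≤ 1}, fun t ht hlt => ?_⟩
  have htc : t < c := by
    refine lt_of_ofReal_lt_eLpNorm_top (fun x => ?_) hlt
    rw [abs_of_nonneg (by positivity)]
    exact mul_le_of_le_one_right hc.le
      (Real.exp_le_one_iff.2 (neg_nonpos.2 (apply_nonneg p x)))
  refine ⟨Real.log (c / t), Real.log_pos ((one_lt_div ht).2 htc), 0, ?_⟩
  rw [Set.singleton_zero, zero_add, levelSet_const_mul_exp_neg p ht htc]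

/-- The radius of the balls found inside level sets of small volume. The ball of radius `1 / 960`
lies in every level set of measure at least `1 - 1 / 1000000`; the next factor is the ratio of
radii that corresponds to the ratio of volumes in
`IsLogConcaveDensity.exists_levels_of_comparable_volume`, and `3` majorizes the number `e` of
`volume_sum_abs_div_le`. -/
noncomputable def levelSetInradius : ℝ := 1 / 960 / (16 / (1 / 1000000) ^ 2) / 3

theorem levelSetInradius_pos : 0 < levelSetInradius := by
  unfold levelSetInradius
  positivity

theorem HasHomogeneousLevelSets.exists_closedBall_subset_levelSet (hn : n ≠ 0)
    (hh : HasHomogeneousLevelSets μ) (hμ : IsIsotropicMeasure μ) (hlc : IsLogConcaveMeasure μ)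
    (hf : IsLogConcaveDensity f μ) :
    ∃ t : ℝ, 0 < t ∧ volume (levelSet f t) ≤ ENNReal.ofReal 2 / eLpNorm f ∞ volume ∧
      ∃ y, Metric.closedBall y levelSetInradius ⊆ levelSet f t := by
  have := hμ.isProbabilityMeasure
  have : NeZero n := ⟨hn⟩
  obtain ⟨g, hg, K, hK⟩ := hh
  obtain ⟨t₀, t₁, ht₁, ht, hlt, hμt, hvol, hratio⟩ :=
    hg.exists_levels_of_comparable_volume hn (δ := 1 / 1000000) (by norm_num) (by norm_num)
  have ht₀ : 0 < t₀ := ht₁.trans_le ht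
  have hball := (hμ.ball_subset_interior hlc hg.absolutelyContinuous (hg.convex_levelSet ht₁)
    hμt).trans interior_subset
  have hpos : volume (levelSet g t₁) ≠ 0 := fun h =>
    (Metric.measure_ball_pos volume _ (by norm_num)).ne' (measure_mono_null hball h)
  obtain ⟨r₀, hr₀, y₀, hy₀⟩ := hK t₀ ht₀ hlt
  obtain ⟨r₁, hr₁, y₁, hy₁⟩ := hK t₁ ht₁ ((ENNReal.ofReal_le_ofReal ht).trans_lt hlt)
  set r := r₀ / r₁
  have hr : 0 < r := div_pos hr₀ hr₁
  have hdilate : levelSet g t₀ = {y₀ - r • y₁} + r • levelSet g t₁ := by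
    rw [hy₀, hy₁, singleton_add_smul_eq_singleton_add_smul hr₁.ne']
  have hBr : 1 ≤ 16 / (1 / 1000000) ^ 2 * r := by
    refine one_le_mul_of_addHaar_le_mul_addHaar_dilate volume hpos (hg.volume_levelSet_ne_top ht₁)
      (by positivity) hr.le (y := y₀ - r • y₁) ?_
    rwa [finrank_euclideanSpace_fin, ← hdilate]
  have hρ : levelSetInradius < r * (1 / 960) := by
    unfold levelSetInradius
    linarith
  refine ⟨t₀, ht₀, ?_, y₀ - r • y₁, ?_⟩
  · rwa [measure_congr (hf.levelSet_ae_eq hg t₀), eLpNorm_congr_ae (hf.ae_eq hg)]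
  · have hsub : Metric.ball (y₀ - r • y₁) (r * (1 / 960)) ⊆ levelSet g t₀ :=
      hdilate ▸ ball_subset_singleton_add_smul hr hball _
    refine ((Metric.closedBall_subset_ball hρ).trans
      (interior_maximal hsub Metric.isOpen_ball)).trans ?_
    rw [hg.interior_levelSet_eq hf ht₀]
    exact interior_subset

namespace IsOneSymmetric

theorem euclideanCube_subset_interior_levelSet [IsProbabilityMeasure μ] (hn : n ≠ 0)
    (hs : IsOneSymmetric μ) (hf : IsLogConcaveDensity f μ) {t : ℝ} (ht : 0 < t)
    {x : EuclideanSpace ℝ (Fin n)} (hx : x ∈ interior (levelSet f t)) {a : ℝ}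
    (ha : a ≤ (∑ i, |x i|) / n) : euclideanCube n a ⊆ interior (levelSet f t) :=
  (euclideanCube_subset_euclideanCube n ha).trans <|
    euclideanCube_subset_of_signedPerm_mem hn (hf.convex_levelSet ht).interior
      (fun σ s _ hy => hf.map_mem_interior_levelSet ht (T := signedPerm σ s) (hs σ s) hy) hx

theorem euclideanCube_subset_levelSet_of_measure_compl_le (hn : n ≠ 0) (hs : IsOneSymmetric μ)
    (hμ : IsIsotropicMeasure μ) (hlc : IsLogConcaveMeasure μ) (hf : IsLogConcaveDensity f μ)
    {t : ℝ} (ht : 0 < t) (hμt : μ (levelSet f t)ᶜ ≤ ENNReal.ofReal (1 / 1000000)) :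
    euclideanCube n (1 / 960) ⊆ levelSet f t := by
  have := hμ.isProbabilityMeasure
  obtain ⟨x, hx, hxs⟩ : ∃ x ∈ interior (levelSet f t), 1 / 960 < (∑ i, |x i|) / n := by
    by_contra! hcon
    rw [← measure_congr (hf.absolutelyContinuous.ae_le (hf.interior_levelSet_ae_eq ht).compl)]
      at hμt
    refine (hμ.lt_measure_lt_sum_abs_div hn hlc).not_ge
      ((measure_mono fun x hx hxt => ?_).trans hμt)
    exact (hcon x hxt).not_gt hx
  exact (hs.euclideanCube_subset_interior_levelSet hn hf ht hx hxs.le).trans interior_subset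

theorem euclideanCube_subset_levelSet_of_lt_volume [IsProbabilityMeasure μ] (hn : n ≠ 0)
    (hs : IsOneSymmetric μ) (hf : IsLogConcaveDensity f μ) {t a : ℝ} (ht : 0 < t) (ha : 0 ≤ a)
    (hvol : ENNReal.ofReal ((2 * Real.exp 1 * a) ^ n) < volume (levelSet f t)) :
    euclideanCube n a ⊆ levelSet f t := by
  obtain ⟨x, hx, hxs⟩ : ∃ x ∈ interior (levelSet f t), a < (∑ i, |x i|) / n := by
    by_contra! hcon
    rw [← measure_congr (hf.interior_levelSet_ae_eq ht)] at hvol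
    exact hvol.not_ge ((measure_mono hcon).trans (volume_sum_abs_div_le hn ha))
  exact (hs.euclideanCube_subset_interior_levelSet hn hf ht hx hxs.le).trans interior_subset

theorem exists_closedBall_subset_levelSet (hn : n ≠ 0) (hs : IsOneSymmetric μ)
    (hμ : IsIsotropicMeasure μ) (hlc : IsLogConcaveMeasure μ) (hf : IsLogConcaveDensity f μ) :
    ∃ t : ℝ, 0 < t ∧ volume (levelSet f t) ≤ ENNReal.ofReal 2 / eLpNorm f ∞ volume ∧
      ∃ y, Metric.closedBall y levelSetInradius ⊆ levelSet f t := by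
  have := hμ.isProbabilityMeasure
  obtain ⟨t₀, t₁, ht₁, ht, -, hμt, hvol, hratio⟩ :=
    hf.exists_levels_of_comparable_volume hn (δ := 1 / 1000000) (by norm_num) (by norm_num)
  have ht₀ : 0 < t₀ := ht₁.trans_le ht
  have hcube : ENNReal.ofReal ((2 * (1 / 960)) ^ n) ≤ volume (levelSet f t₁) := by
    have := measure_mono (μ := volume)
      (hs.euclideanCube_subset_levelSet_of_measure_compl_le hn hμ hlc hf ht₁ hμt)
    rwa [volume_euclideanCube, ← ENNReal.ofReal_pow (by norm_num)] at this
  have hlt : ENNReal.ofReal ((2 * Real.exp 1 * levelSetInradius) ^ n) <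
      volume (levelSet f t₀) := by
    by_contra! hle
    have hpow : ENNReal.ofReal ((2 * (1 / 960)) ^ n) ≤ ENNReal.ofReal
        ((16 / (1 / 1000000) ^ 2 * (2 * Real.exp 1 * levelSetInradius)) ^ n) := by
      rw [mul_pow (16 / (1 / 1000000) ^ 2 : ℝ), ENNReal.ofReal_mul (by positivity)]
      exact hcube.trans (hratio.trans (by gcongr))
    have hnonneg := levelSetInradius_pos.le
    rw [ENNReal.ofReal_le_ofReal_iff (by positivity)] at hpow
    have hbase := le_of_pow_le_pow_left₀ hn (by positivity) hpow
    unfold levelSetInradius at hbase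
    linarith [Real.exp_one_lt_d9]
  exact ⟨t₀, ht₀, hvol, 0, (closedBall_subset_euclideanCube n _).trans
    (hs.euclideanCube_subset_levelSet_of_lt_volume hn hf ht₀ levelSetInradius_pos.le hlt)⟩

end IsOneSymmetric

theorem IsIsotropicMeasure.exists_closedBall_subset_levelSet (hn : n ≠ 0)
    (hμ : IsIsotropicMeasure μ) (hlc : IsLogConcaveMeasure μ)
    (hclass : IsUniformOnConvex μ ∨ HasHomogeneousLevelSets μ ∨ IsOneSymmetric μ)
    (hf : IsLogConcaveDensity f μ) :
    ∃ t : ℝ, 0 < t ∧ volume (levelSet f t) ≤ ENNReal.ofReal 2 / eLpNorm f ∞ volume ∧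
      ∃ y, Metric.closedBall y levelSetInradius ⊆ levelSet f t := by
  rcases hclass with hu | hh | hs
  · exact hu.hasHomogeneousLevelSets.exists_closedBall_subset_levelSet hn hμ hlc hf
  · exact hh.exists_closedBall_subset_levelSet hn hμ hlc hf
  · exact hs.exists_closedBall_subset_levelSet hn hμ hlc hf

theorem IsLogConcaveDensity.maxPerimeter_le_of_volume_levelSet_le (hf : IsLogConcaveDensity f μ)
    [IsProbabilityMeasure μ] {t ρ C : ℝ} {y : EuclideanSpace ℝ (Fin n)} (ht : 0 < t) (hρ : 0 < ρ)
    (hC : 0 ≤ C) (hvol : volume (levelSet f t) ≤ ENNReal.ofReal C / eLpNorm f ∞ volume)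
    (hball : Metric.closedBall y ρ ⊆ levelSet f t) :
    maxPerimeter μ ≤ ENNReal.ofReal ((1 + C) / ρ * n) := by
  have hle : eLpNorm f ∞ volume * volume (levelSet f t) ≤ ENNReal.ofReal C :=
    (mul_le_mul_right hvol _).trans ENNReal.mul_div_le
  refine (hf.maxPerimeter_le ht hρ hball).trans ?_
  rw [mul_comm_div, mul_comm, ENNReal.ofReal_mul (by positivity),
    ENNReal.ofReal_add zero_le_one hC, ENNReal.ofReal_one]
  gcongr

end Classes

/-! ### The Prékopa–Leindler inequality -/

section PrekopaLeindler

variable {l : ℝ}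

theorem volume_add_volume_le_volume_add {A B : Set ℝ} (hA : IsCompact A) (hB : IsCompact B)
    (hA₀ : A.Nonempty) (hB₀ : B.Nonempty) : volume A + volume B ≤ volume (A + B) := by
  -- `A + inf B` and `sup A + B` are translates inside `A + B` with one common point.
  have hsup := hA.sSup_mem hA₀
  have hinf := hB.sInf_mem hB₀
  have hsub : (· + sInf B) '' A ∪ (sSup A + ·) '' B ⊆ A + B := by
    rintro _ (⟨x, hx, rfl⟩ | ⟨x, hx, rfl⟩)
    · exact Set.add_mem_add hx hinf
    · exact Set.add_mem_add hsup hx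
  have hdisj : AEDisjoint volume ((· + sInf B) '' A) ((sSup A + ·) '' B) := by
    refine measure_mono_null ?_ (measure_singleton (sSup A + sInf B))
    rintro _ ⟨⟨x, hx, rfl⟩, y, hy, hxy⟩
    have hxA := le_csSup hA.bddAbove hx
    have hyB := csInf_le hB.bddBelow hy
    simp only [Set.mem_singleton_iff] at hxy ⊢
    linarith
  have hmeas : MeasurableSet ((sSup A + ·) '' B) := (hB.image (by fun_prop)).measurableSet
  calc volume A + volume B
      = volume ((· + sInf B) '' A ∪ (sSup A + ·) '' B) := by
        rw [measure_union₀ hmeas.nullMeasurableSet hdisj, Set.image_add_right,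
          measure_preimage_add_right, Set.image_add_left, measure_preimage_add]
    _ ≤ volume (A + B) := measure_mono hsub

theorem volume_add_volume_le_volume_of_convexCombo_subset {A B C : Set ℝ} (hA : MeasurableSet A)
    (hB : MeasurableSet B) (hA₀ : A.Nonempty) (hB₀ : B.Nonempty) (h0 : 0 < l) (h1 : l < 1)
    (hC : l • A + (1 - l) • B ⊆ C) :
    ENNReal.ofReal l * volume A + ENNReal.ofReal (1 - l) * volume B ≤ volume C := by
  obtain ⟨a, ha⟩ := hA₀
  obtain ⟨b, hb⟩ := hB₀
  rw [hA.measure_eq_iSup_isCompact, hB.measure_eq_iSup_isCompact]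
  simp only [ENNReal.mul_iSup, iSup_and']
  refine ENNReal.biSup_add_biSup_le' ⟨∅, Set.empty_subset _, isCompact_empty⟩
    ⟨∅, Set.empty_subset _, isCompact_empty⟩ fun K hK L hL => ?_
  have hsum := volume_add_volume_le_volume_add ((hK.2.insert a).smul l)
    ((hL.2.insert b).smul (1 - l)) (Set.insert_nonempty _ _).smul_set
    (Set.insert_nonempty _ _).smul_set
  rw [Measure.addHaar_smul, Measure.addHaar_smul, Module.finrank_self, pow_one, pow_one,
    abs_of_pos h0, abs_of_pos (sub_pos.2 h1)] at hsum
  calc ENNReal.ofReal l * volume K + ENNReal.ofReal (1 - l) * volume L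
      ≤ ENNReal.ofReal l * volume (insert a K) + ENNReal.ofReal (1 - l) * volume (insert b L) := by
        gcongr <;> exact Set.subset_insert _ _
    _ ≤ volume (l • insert a K + (1 - l) • insert b L) := hsum
    _ ≤ volume C := measure_mono <| subset_trans (Set.add_subset_add
        (Set.smul_set_mono (Set.insert_subset ha hK.1))
        (Set.smul_set_mono (Set.insert_subset hb hL.1))) hC

theorem lintegral_eq_lintegral_measure_ofReal_lt {α : Type*} [MeasurableSpace α] {ν : Measure α}
    {f : α → ℝ≥0∞} (hf : Measurable f) (hf' : ∀ x, f x ≠ ∞) :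
    ∫⁻ x, f x ∂ν = ∫⁻ t in Set.Ioi 0, ν {x | ENNReal.ofReal t < f x} := by
  calc ∫⁻ x, f x ∂ν = ∫⁻ x, ENNReal.ofReal (f x).toReal ∂ν := by
        simp only [ENNReal.ofReal_toReal (hf' _)]
    _ = ∫⁻ t in Set.Ioi 0, ν {x | t < (f x).toReal} :=
        lintegral_eq_lintegral_meas_lt ν (.of_forall fun _ => ENNReal.toReal_nonneg)
          hf.ennreal_toReal.aemeasurable
    _ = ∫⁻ t in Set.Ioi 0, ν {x | ENNReal.ofReal t < f x} :=
        setLIntegral_congr_fun measurableSet_Ioi fun t ht => by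
          simp only [ENNReal.ofReal_lt_iff_lt_toReal (le_of_lt (Set.mem_Ioi.1 ht)) (hf' _)]

theorem lt_rpow_mul_rpow_of_lt_of_lt {a b t : ℝ≥0∞} (h0 : 0 < l) (h1 : l < 1) (ha : t < a)
    (hb : t < b) : t < a ^ l * b ^ (1 - l) :=
  calc t = t ^ l * t ^ (1 - l) := by
        rw [← ENNReal.rpow_add_of_nonneg _ _ h0.le (sub_pos.2 h1).le, add_sub_cancel,
          ENNReal.rpow_one]
    _ < a ^ l * b ^ (1 - l) := ENNReal.mul_lt_mul (ENNReal.rpow_lt_rpow ha h0)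
        (ENNReal.rpow_lt_rpow hb (sub_pos.2 h1))

theorem rpow_mul_rpow_le_ofReal_mul_add (a b : ℝ≥0∞) (h0 : 0 < l) (h1 : l < 1) :
    a ^ l * b ^ (1 - l) ≤ ENNReal.ofReal l * a + ENNReal.ofReal (1 - l) * b := by
  have h1' := sub_pos.2 h1
  rcases eq_or_ne a ∞ with rfl | ha
  · rw [ENNReal.mul_top (ENNReal.ofReal_pos.2 h0).ne', top_add]
    exact le_top
  rcases eq_or_ne b ∞ with rfl | hb
  · rw [ENNReal.mul_top (ENNReal.ofReal_pos.2 h1').ne', add_top]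
    exact le_top
  lift a to NNReal using ha
  lift b to NNReal using hb
  have hamgm := ENNReal.ofReal_le_ofReal (Real.geom_mean_le_arith_mean2_weighted h0.le h1'.le
    a.coe_nonneg b.coe_nonneg (add_sub_cancel l 1))
  rwa [ENNReal.ofReal_mul (by positivity), ENNReal.ofReal_add (by positivity) (by positivity),
    ENNReal.ofReal_mul h0.le, ENNReal.ofReal_mul h1'.le,
    ← ENNReal.ofReal_rpow_of_nonneg a.coe_nonneg h0.le,
    ← ENNReal.ofReal_rpow_of_nonneg b.coe_nonneg h1'.le,
    ENNReal.ofReal_coe_nnreal, ENNReal.ofReal_coe_nnreal] at hamgm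

theorem lintegral_add_lintegral_le_of_iSup_eq_one {f g h : ℝ → ℝ≥0∞} (hf : Measurable f)
    (hg : Measurable g) (hh : Measurable h) (hf1 : ⨆ x, f x = 1) (hg1 : ⨆ x, g x = 1)
    (h0 : 0 < l) (h1 : l < 1)
    (hfg : ∀ x y, f x ^ l * g y ^ (1 - l) ≤ h (l • x + (1 - l) • y)) :
    ENNReal.ofReal l * (∫⁻ x, f x) + ENNReal.ofReal (1 - l) * (∫⁻ x, g x) ≤ ∫⁻ x, h x := by
  have hfle (x) : f x ≤ 1 := (le_iSup f x).trans hf1.le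
  have hgle (x) : g x ≤ 1 := (le_iSup g x).trans hg1.le
  have hanti : Antitone fun t => volume {x | ENNReal.ofReal t < f x} := fun s t hst =>
    measure_mono fun x hx => (ENNReal.ofReal_le_ofReal hst).trans_lt hx
  refine le_trans ?_ (lintegral_mono fun x => min_le_left (h x) 1)
  rw [lintegral_eq_lintegral_measure_ofReal_lt hf
      fun x => ne_top_of_le_ne_top ENNReal.one_ne_top (hfle x),
    lintegral_eq_lintegral_measure_ofReal_lt hg
      fun x => ne_top_of_le_ne_top ENNReal.one_ne_top (hgle x),
    lintegral_eq_lintegral_measure_ofReal_lt (hh.min measurable_const)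
      fun x => ne_top_of_le_ne_top ENNReal.one_ne_top (min_le_right _ _),
    ← lintegral_const_mul' _ _ ENNReal.ofReal_ne_top,
    ← lintegral_const_mul' _ _ ENNReal.ofReal_ne_top,
    ← lintegral_add_left (hanti.measurable.const_mul _)]
  refine lintegral_mono fun t => ?_
  rcases lt_or_ge (ENNReal.ofReal t) 1 with ht | ht
  · refine volume_add_volume_le_volume_of_convexCombo_subset (measurableSet_lt measurable_const hf)
      (measurableSet_lt measurable_const hg) (lt_iSup_iff.1 (ht.trans_eq hf1.symm))
      (lt_iSup_iff.1 (ht.trans_eq hg1.symm)) h0 h1 ?_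
    rintro _ ⟨_, ⟨x, hx, rfl⟩, _, ⟨y, hy, rfl⟩, rfl⟩
    exact lt_min ((lt_rpow_mul_rpow_of_lt_of_lt h0 h1 hx hy).trans_le (hfg x y)) ht
  · have hempty {k : ℝ → ℝ≥0∞} (hk : ∀ x, k x ≤ 1) : {x | ENNReal.ofReal t < k x} = ∅ :=
      Set.eq_empty_of_forall_notMem fun x hx => (hk x).not_gt (ht.trans_lt hx)
    simp only [hempty hfle, hempty hgle, measure_empty, mul_zero, add_zero, zero_le]

theorem div_rpow_mul_div_rpow {F G : ℝ≥0∞} (hF : F ≠ ∞) (hG : G ≠ ∞) (h0 : 0 ≤ l) (h1 : l ≤ 1)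
    (a b : ℝ≥0∞) :
    (a / F) ^ l * (b / G) ^ (1 - l) = a ^ l * b ^ (1 - l) / (F ^ l * G ^ (1 - l)) := by
  have h1' := sub_nonneg.2 h1
  rw [ENNReal.div_rpow_of_nonneg _ _ h0, ENNReal.div_rpow_of_nonneg _ _ h1', div_eq_mul_inv,
    div_eq_mul_inv, mul_mul_mul_comm, ← ENNReal.mul_inv
      (.inr (ENNReal.rpow_ne_top_of_nonneg h1' hG)) (.inl (ENNReal.rpow_ne_top_of_nonneg h0 hF)),
    div_eq_mul_inv]

theorem prekopa_leindler_real_of_iSup_ne_top {f g h : ℝ → ℝ≥0∞} (hf : Measurable f)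
    (hg : Measurable g) (hh : Measurable h) (hF : ⨆ x, f x ≠ ∞) (hG : ⨆ x, g x ≠ ∞) (h0 : 0 < l)
    (h1 : l < 1) (hfg : ∀ x y, f x ^ l * g y ^ (1 - l) ≤ h (l • x + (1 - l) • y)) :
    (∫⁻ x, f x) ^ l * (∫⁻ x, g x) ^ (1 - l) ≤ ∫⁻ x, h x := by
  have h1' := sub_pos.2 h1
  rcases eq_or_ne (⨆ x, f x) 0 with hF₀ | hF₀
  · simp [ENNReal.iSup_eq_zero.1 hF₀, h0]
  rcases eq_or_ne (⨆ x, g x) 0 with hG₀ | hG₀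
  · simp [ENNReal.iSup_eq_zero.1 hG₀, h1]
  set F := ⨆ x, f x
  set G := ⨆ x, g x
  set P := F ^ l * G ^ (1 - l)
  have hP₀ : P ≠ 0 := mul_ne_zero (by simp [ENNReal.rpow_eq_zero_iff, hF₀, hF])
    (by simp [ENNReal.rpow_eq_zero_iff, hG₀, hG])
  have hP : P ≠ ∞ := ENNReal.mul_ne_top (ENNReal.rpow_ne_top_of_nonneg h0.le hF)
    (ENNReal.rpow_ne_top_of_nonneg h1'.le hG)
  have hint {k : ℝ → ℝ≥0∞} (hk : Measurable k) (c : ℝ≥0∞) :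
      ∫⁻ x, k x / c = (∫⁻ x, k x) / c := by
    simp only [div_eq_mul_inv, lintegral_mul_const _ hk]
  have hnormalized := lintegral_add_lintegral_le_of_iSup_eq_one (hf.div_const F) (hg.div_const G)
    (hh.div_const P) (by rw [← ENNReal.iSup_div, ENNReal.div_self hF₀ hF])
    (by rw [← ENNReal.iSup_div, ENNReal.div_self hG₀ hG]) h0 h1 fun x y => by
      rw [div_rpow_mul_div_rpow hF hG h0.le h1.le]
      exact ENNReal.div_le_div_right (hfg x y) P
  have hdiv := (rpow_mul_rpow_le_ofReal_mul_add _ _ h0 h1).trans hnormalized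
  rw [hint hf, hint hg, hint hh, div_rpow_mul_div_rpow hF hG h0.le h1.le] at hdiv
  exact ((ENNReal.div_le_iff hP₀ hP).1 hdiv).trans_eq (ENNReal.div_mul_cancel hP₀ hP)

theorem lintegral_rpow_eq_iSup_lintegral_min {α : Type*} [MeasurableSpace α] {ν : Measure α}
    {f : α → ℝ≥0∞} (hf : Measurable f) {p : ℝ} (hp : 0 < p) :
    (∫⁻ x, f x ∂ν) ^ p = ⨆ N : ℕ, (∫⁻ x, min (f x) N ∂ν) ^ p := by
  have hmin (x) : ⨆ N : ℕ, min (f x) N = f x := by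
    rw [← inf_iSup_eq, ENNReal.iSup_natCast, inf_top_eq]
  have hiSup : ∫⁻ x, f x ∂ν = ⨆ N : ℕ, ∫⁻ x, min (f x) N ∂ν := by
    rw [← lintegral_iSup (fun N => hf.min measurable_const)
      fun N M hNM x => min_le_min_left _ (Nat.mono_cast hNM)]
    simp only [hmin]
  rw [hiSup]
  exact (ENNReal.orderIsoRpow p hp).map_iSup _

theorem prekopa_leindler_real {f g h : ℝ → ℝ≥0∞} (hf : Measurable f) (hg : Measurable g)
    (hh : Measurable h) (h0 : 0 < l) (h1 : l < 1)
    (hfg : ∀ x y, f x ^ l * g y ^ (1 - l) ≤ h (l • x + (1 - l) • y)) :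
    (∫⁻ x, f x) ^ l * (∫⁻ x, g x) ^ (1 - l) ≤ ∫⁻ x, h x := by
  have hbdd (k : ℝ → ℝ≥0∞) (N : ℕ) : ⨆ x, min (k x) N ≠ ∞ :=
    ne_top_of_le_ne_top (ENNReal.natCast_ne_top N) (iSup_le fun x => min_le_right _ _)
  have h1' := sub_pos.2 h1
  rw [lintegral_rpow_eq_iSup_lintegral_min hf h0, lintegral_rpow_eq_iSup_lintegral_min hg h1']
  simp only [ENNReal.iSup_mul, ENNReal.mul_iSup]
  refine iSup₂_le fun M N => prekopa_leindler_real_of_iSup_ne_top (hf.min measurable_const)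
    (hg.min measurable_const) hh (hbdd f _) (hbdd g _) h0 h1 fun x y => le_trans ?_ (hfg x y)
  gcongr <;> exact min_le_left _ _

theorem measurable_finCons {n : ℕ} :
    Measurable fun z : ℝ × (Fin n → ℝ) => (Fin.cons z.1 z.2 : Fin (n + 1) → ℝ) :=
  measurable_pi_iff.2 <| Fin.cases measurable_fst fun i =>
    (measurable_pi_apply i).comp measurable_snd

theorem lintegral_eq_lintegral_lintegral_finCons {n : ℕ} {f : (Fin (n + 1) → ℝ) → ℝ≥0∞}
    (hf : Measurable f) : ∫⁻ x, f x = ∫⁻ a : ℝ, ∫⁻ y : Fin n → ℝ, f (Fin.cons a y) := by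
  have hcons (z : ℝ × (Fin n → ℝ)) :
      (MeasurableEquiv.piFinSuccAbove (fun _ : Fin (n + 1) => ℝ) 0).symm z = Fin.cons z.1 z.2 :=
    Fin.insertNth_zero' z.1 z.2
  rw [← (volume_preserving_piFinSuccAbove (fun _ : Fin (n + 1) => ℝ) 0).symm.lintegral_comp hf]
  simp only [hcons]
  exact lintegral_prod (fun z : ℝ × (Fin n → ℝ) => f (Fin.cons z.1 z.2))
    (hf.comp measurable_finCons).aemeasurable

theorem prekopa_leindler (h0 : 0 < l) (h1 : l < 1) (n : ℕ) {f g h : (Fin n → ℝ) → ℝ≥0∞}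
    (hf : Measurable f) (hg : Measurable g) (hh : Measurable h)
    (hfg : ∀ x y, f x ^ l * g y ^ (1 - l) ≤ h (l • x + (1 - l) • y)) :
    (∫⁻ x, f x) ^ l * (∫⁻ x, g x) ^ (1 - l) ≤ ∫⁻ x, h x := by
  induction n with
  | zero =>
    have hvol : volume (Set.univ : Set (Fin 0 → ℝ)) = 1 := by
      rw [← Set.pi_univ Set.univ, volume_pi_pi, Finset.univ_eq_empty, Finset.prod_empty]
    simp only [lintegral_unique, hvol, mul_one]
    exact (hfg _ _).trans_eq (congrArg h (Subsingleton.elim _ _))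
  | succ n ih =>
    have hslice {k : (Fin (n + 1) → ℝ) → ℝ≥0∞} (hk : Measurable k) (a : ℝ) :
        Measurable fun y : Fin n → ℝ => k (Fin.cons a y) :=
      hk.comp (measurable_finCons.comp measurable_prodMk_left)
    have hmarginal {k : (Fin (n + 1) → ℝ) → ℝ≥0∞} (hk : Measurable k) :
        Measurable fun a : ℝ => ∫⁻ y : Fin n → ℝ, k (Fin.cons a y) :=
      (hk.comp measurable_finCons).lintegral_prod_right'
    rw [lintegral_eq_lintegral_lintegral_finCons hf, lintegral_eq_lintegral_lintegral_finCons hg,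
      lintegral_eq_lintegral_lintegral_finCons hh]
    refine prekopa_leindler_real (hmarginal hf) (hmarginal hg) (hmarginal hh) h0 h1 fun a b =>
      ih (hslice hf a) (hslice hg b) (hslice hh _) fun x y =>
        (hfg (Fin.cons a x) (Fin.cons b y)).trans_eq (congrArg h ?_)
    ext i
    refine Fin.cases ?_ (fun j => ?_) i <;> simp

theorem isLogConcaveMeasure_volume (n : ℕ) :
    IsLogConcaveMeasure (volume : Measure (EuclideanSpace ℝ (Fin n))) := by
  intro A B hA hB l h0 h1
  have hvol {S : Set (EuclideanSpace ℝ (Fin n))} (hS : MeasurableSet S) :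
      volume S = ∫⁻ x : Fin n → ℝ, S.indicator 1 (WithLp.toLp 2 x) := by
    rw [(PiLp.volume_preserving_toLp (Fin n)).lintegral_comp (measurable_one.indicator hS),
      lintegral_indicator_one hS]
  have hmeas {S : Set (EuclideanSpace ℝ (Fin n))} (hS : MeasurableSet S) :
      Measurable fun x : Fin n → ℝ => S.indicator (fun _ => (1 : ℝ≥0∞)) (WithLp.toLp 2 x) :=
    (measurable_one.indicator hS).comp (PiLp.volume_preserving_toLp (Fin n)).measurable
  have hC := measurableSet_toMeasurable volume (l • A + (1 - l) • B)
  rw [← measure_toMeasurable (l • A + (1 - l) • B), hvol hA, hvol hB, hvol hC]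
  refine prekopa_leindler h0 h1 n (hmeas hA) (hmeas hB) (hmeas hC) fun x y => ?_
  by_cases hx : WithLp.toLp 2 x ∈ A
  · by_cases hy : WithLp.toLp 2 y ∈ B
    · have hxy : WithLp.toLp 2 (l • x + (1 - l) • y) ∈
          toMeasurable volume (l • A + (1 - l) • B) := subset_toMeasurable _ _ <|
        Set.add_mem_add (Set.smul_mem_smul_set hx) (Set.smul_mem_smul_set hy)
      rw [Set.indicator_of_mem hx, Set.indicator_of_mem hy, Set.indicator_of_mem hxy]
      simp
    · rw [Set.indicator_of_notMem hy, ENNReal.zero_rpow_of_pos (sub_pos.2 h1), mul_zero]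
      exact zero_le
  · rw [Set.indicator_of_notMem hx, ENNReal.zero_rpow_of_pos h0, zero_mul]
    exact zero_le

end PrekopaLeindler

/-! ### The uniform measure on the cube -/

section UniformCube

variable {n : ℕ} {μ : Measure (EuclideanSpace ℝ (Fin n))}

namespace IsLogConcaveMeasure

theorem const_smul (hμ : IsLogConcaveMeasure μ) (c : ℝ≥0∞) : IsLogConcaveMeasure (c • μ) := by
  intro A B hA hB l h0 h1
  have h1' := sub_pos.2 h1
  simp only [Measure.smul_apply, smul_eq_mul]
  rw [ENNReal.mul_rpow_of_nonneg _ _ h0.le, ENNReal.mul_rpow_of_nonneg _ _ h1'.le,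
    mul_mul_mul_comm, ← ENNReal.rpow_add_of_nonneg _ _ h0.le h1'.le, add_sub_cancel,
    ENNReal.rpow_one]
  gcongr
  exact hμ A B hA hB l h0 h1

theorem restrict (hμ : IsLogConcaveMeasure μ) {K : Set (EuclideanSpace ℝ (Fin n))}
    (hK : Convex ℝ K) (hKm : MeasurableSet K) : IsLogConcaveMeasure (μ.restrict K) := by
  intro A B hA hB l h0 h1
  simp only [Measure.restrict_apply' hKm]
  refine (hμ _ _ (hA.inter hKm) (hB.inter hKm) l h0 h1).trans (measure_mono ?_)
  rintro _ ⟨_, ⟨x, hx, rfl⟩, _, ⟨y, hy, rfl⟩, rfl⟩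
  exact ⟨Set.add_mem_add (Set.smul_mem_smul_set hx.1) (Set.smul_mem_smul_set hy.1),
    hK hx.2 hy.2 h0.le (sub_pos.2 h1).le (add_sub_cancel l 1)⟩

end IsLogConcaveMeasure

namespace IsOneSymmetric

theorem measurePreserving_signedPerm (hs : IsOneSymmetric μ) (σ : Equiv.Perm (Fin n))
    (s : Fin n → ℤˣ) : MeasurePreserving (signedPerm σ s) μ μ :=
  ⟨(signedPerm σ s).continuous.measurable, hs σ s⟩

theorem integral_comp_signedPerm {V : Type*} [NormedAddCommGroup V] [NormedSpace ℝ V]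
    (hs : IsOneSymmetric μ) (σ : Equiv.Perm (Fin n)) (s : Fin n → ℤˣ)
    (g : EuclideanSpace ℝ (Fin n) → V) : ∫ x, g (signedPerm σ s x) ∂μ = ∫ x, g x ∂μ :=
  (hs.measurePreserving_signedPerm σ s).integral_comp
    (signedPerm σ s).toHomeomorph.measurableEmbedding g

theorem integral_id_eq_zero (hs : IsOneSymmetric μ) : ∫ x, x ∂μ = 0 := by
  have hneg (x : EuclideanSpace ℝ (Fin n)) : signedPerm 1 (fun _ => -1) x = -x := by
    ext i
    simp [signedPerm_apply]
  have hint := hs.integral_comp_signedPerm 1 (fun _ => -1) fun x => x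
  simp only [hneg] at hint
  rw [integral_neg, neg_eq_iff_add_eq_zero, ← two_smul ℝ] at hint
  exact (smul_eq_zero.1 hint).resolve_left two_ne_zero

theorem integral_apply_mul_apply_eq_zero (hs : IsOneSymmetric μ) {i j : Fin n} (hij : i ≠ j) :
    ∫ x, x i * x j ∂μ = 0 := by
  have hint := hs.integral_comp_signedPerm 1 (fun k => if k = i then -1 else 1) fun x => x i * x j
  simp only [signedPerm_apply, Equiv.Perm.coe_one, id_eq, if_true, if_neg hij.symm, Units.val_neg,
    Units.val_one, Int.cast_neg, Int.cast_one, neg_mul, one_mul, integral_neg] at hint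
  exact self_eq_neg.1 hint.symm

theorem integral_inner_sq (hs : IsOneSymmetric μ)
    (hint : ∀ i, Integrable (fun x : EuclideanSpace ℝ (Fin n) => x i ^ 2) μ)
    (θ : EuclideanSpace ℝ (Fin n)) :
    ∫ x, inner ℝ x θ ^ 2 ∂μ = ∑ i, θ i ^ 2 * ∫ x, x i ^ 2 ∂μ := by
  have hL2 (i : Fin n) : MemLp (fun x : EuclideanSpace ℝ (Fin n) => x i) 2 μ :=
    (memLp_two_iff_integrable_sq (by fun_prop)).2 (hint i)
  have hexpand (x : EuclideanSpace ℝ (Fin n)) :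
      inner ℝ x θ ^ 2 = ∑ i, ∑ j, θ i * θ j * (x i * x j) := by
    rw [PiLp.inner_apply, sq, Finset.sum_mul_sum]
    refine Finset.sum_congr rfl fun i _ => Finset.sum_congr rfl fun j _ => ?_
    simp only [RCLike.inner_apply, conj_trivial]
    ring
  have hterm (i j : Fin n) :
      Integrable (fun x : EuclideanSpace ℝ (Fin n) => θ i * θ j * (x i * x j)) μ :=
    ((hL2 i).integrable_mul (hL2 j)).const_mul _
  simp only [hexpand]
  rw [integral_finsetSum _ fun i _ => integrable_finsetSum _ fun j _ => hterm i j]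
  refine Finset.sum_congr rfl fun i _ => ?_
  rw [integral_finsetSum _ fun j _ => hterm i j, Finset.sum_eq_single i]
  · simp only [integral_const_mul, ← sq]
  · intro j _ hj
    rw [integral_const_mul, hs.integral_apply_mul_apply_eq_zero hj.symm, mul_zero]
  · exact fun hi => absurd (Finset.mem_univ i) hi

theorem isIsotropicMeasure [IsProbabilityMeasure μ] (hs : IsOneSymmetric μ)
    (hsq : ∀ i, ∫ x, x i ^ 2 ∂μ = 1) : IsIsotropicMeasure μ where
  isProbabilityMeasure := inferInstance
  barycenter_eq_zero := hs.integral_id_eq_zero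
  second_moment θ hθ := by
    rw [hs.integral_inner_sq (fun i => Integrable.of_integral_ne_zero (by simp [hsq i])) θ]
    simp only [hsq, mul_one]
    rw [← EuclideanSpace.real_norm_sq_eq, hθ, one_pow]

end IsOneSymmetric

/-- The uniform probability measure on the cube `[-a, a]^n`, for `a > 0`. -/
noncomputable def uniformCube (n : ℕ) (a : ℝ) : Measure (EuclideanSpace ℝ (Fin n)) :=
  (volume (euclideanCube n a))⁻¹ • volume.restrict (euclideanCube n a)

theorem volume_euclideanCube_ne_zero {a : ℝ} (ha : 0 < a) : volume (euclideanCube n a) ≠ 0 := by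
  rw [volume_euclideanCube]
  exact pow_ne_zero _ (ENNReal.ofReal_pos.2 (by positivity)).ne'

theorem volume_euclideanCube_ne_top (a : ℝ) : volume (euclideanCube n a) ≠ ∞ := by
  rw [volume_euclideanCube]
  exact ENNReal.pow_ne_top ENNReal.ofReal_ne_top

theorem isUniformOnConvex_uniformCube (n : ℕ) {a : ℝ} (ha : 0 < a) :
    IsUniformOnConvex (uniformCube n a) :=
  ⟨euclideanCube n a, convex_euclideanCube n a, volume_euclideanCube_ne_zero ha,
    volume_euclideanCube_ne_top a, rfl⟩

theorem isProbabilityMeasure_uniformCube (n : ℕ) {a : ℝ} (ha : 0 < a) :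
    IsProbabilityMeasure (uniformCube n a) :=
  ProbabilityTheory.cond_isProbabilityMeasure_of_finite (volume_euclideanCube_ne_zero ha)
    (volume_euclideanCube_ne_top a)

theorem isLogConcaveMeasure_uniformCube (n : ℕ) (a : ℝ) : IsLogConcaveMeasure (uniformCube n a) :=
  ((isLogConcaveMeasure_volume n).restrict (convex_euclideanCube n a)
    (measurableSet_euclideanCube n a)).const_smul _

theorem signedPerm_preimage_euclideanCube (a : ℝ) (σ : Equiv.Perm (Fin n)) (s : Fin n → ℤˣ) :
    signedPerm σ s ⁻¹' euclideanCube n a = euclideanCube n a := by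
  ext x
  have habs (i : Fin n) : |((s i : ℤ) : ℝ) * x (σ i)| = |x (σ i)| := by
    rcases Int.units_eq_one_or (s i) with h | h <;> simp [h]
  simp only [Set.mem_preimage, euclideanCube, Set.mem_ofPred_eq, signedPerm_apply, habs]
  exact σ.forall_congr_right (q := fun i => |x i| ≤ a)

theorem isOneSymmetric_uniformCube (n : ℕ) (a : ℝ) : IsOneSymmetric (uniformCube n a) := by
  intro σ s
  have hrestrict := (signedPerm σ s).measurePreserving.restrict_preimage
    (measurableSet_euclideanCube n a)
  rw [signedPerm_preimage_euclideanCube] at hrestrict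
  exact (Measure.map_smul ..).trans (congrArg _ hrestrict.map_eq)

theorem setIntegral_sq_Icc_neg {a : ℝ} (ha : 0 ≤ a) :
    ∫ t in Set.Icc (-a) a, t ^ 2 = 2 * a * (a ^ 2 / 3) := by
  rw [integral_Icc_eq_integral_Ioc, ← intervalIntegral.integral_of_le (by linarith), integral_pow]
  norm_num
  ring

theorem setIntegral_apply_sq_euclideanCube {a : ℝ} (ha : 0 ≤ a) (i : Fin n) :
    ∫ x in euclideanCube n a, x i ^ 2 = (2 * a) ^ n * (a ^ 2 / 3) := by
  have hfactor (y : Fin n → ℝ) : y i ^ 2 = ∏ j, if j = i then y j ^ 2 else 1 := by simp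
  have hcoord (j : Fin n) : ∫ t in Set.Icc (-a) a, (if j = i then t ^ 2 else 1) =
      2 * a * if j = i then a ^ 2 / 3 else 1 := by
    split_ifs
    · exact setIntegral_sq_Icc_neg ha
    · rw [setIntegral_const, smul_eq_mul, mul_one, mul_one, Real.volume_real_Icc_of_le
        (by linarith)]
      ring
  calc ∫ x in euclideanCube n a, x i ^ 2
      = ∫ y in Set.univ.pi fun _ : Fin n => Set.Icc (-a) a, y i ^ 2 := by
        rw [euclideanCube_eq_preimage]
        exact (EuclideanSpace.volume_preserving_symm_measurableEquiv_toLp (Fin n))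
          |>.setIntegral_preimage_emb (MeasurableEquiv.measurableEmbedding _) (fun y => y i ^ 2) _
    _ = ∏ j : Fin n, ∫ t in Set.Icc (-a) a, (if j = i then t ^ 2 else 1) := by
        simp only [hfactor]
        rw [volume_pi, Measure.restrict_pi_pi]
        exact integral_fintype_prod_eq_prod fun j (t : ℝ) => if j = i then t ^ 2 else 1
    _ = (2 * a) ^ n * (a ^ 2 / 3) := by
        simp only [hcoord, Finset.prod_mul_distrib, Finset.prod_const, Finset.card_univ,
          Fintype.card_fin, Finset.prod_ite_eq', Finset.mem_univ, if_true, mul_pow]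

theorem integral_apply_sq_uniformCube {a : ℝ} (ha : 0 < a) (i : Fin n) :
    ∫ x, x i ^ 2 ∂uniformCube n a = a ^ 2 / 3 := by
  rw [uniformCube, integral_smul_measure, setIntegral_apply_sq_euclideanCube ha.le,
    volume_euclideanCube, ENNReal.toReal_inv, ENNReal.toReal_pow,
    ENNReal.toReal_ofReal (by positivity), smul_eq_mul, inv_mul_cancel_left₀ (by positivity)]

theorem isIsotropicMeasure_uniformCube (n : ℕ) : IsIsotropicMeasure (uniformCube n √3) :=
  have := isProbabilityMeasure_uniformCube n (a := √3) (by positivity)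
  (isOneSymmetric_uniformCube n √3).isIsotropicMeasure fun i => by
    rw [integral_apply_sq_uniformCube (by positivity), Real.sq_sqrt (by norm_num), div_self
      (by norm_num)]

/-- The prism of height `ε` erected over the facet `{x | x i = b}` of the cube `[-b, b]^n`. -/
def facetPrism (b ε : ℝ) (i : Fin n) : Set (EuclideanSpace ℝ (Fin n)) :=
  {x | x i ∈ Set.Ioc b (b + ε) ∧ ∀ j ≠ i, |x j| ≤ b}

theorem facetPrism_eq_preimage (b ε : ℝ) (i : Fin n) :
    facetPrism b ε i = (MeasurableEquiv.toLp 2 (Fin n → ℝ)).symm ⁻¹'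
      Set.univ.pi (Function.update (fun _ => Set.Icc (-b) b) i (Set.Ioc b (b + ε))) := by
  ext x
  simp only [facetPrism, Set.mem_ofPred_eq, Set.mem_preimage, Set.mem_univ_pi]
  rw [Function.forall_update_iff _ fun j (s : Set ℝ) =>
    (MeasurableEquiv.toLp 2 (Fin n → ℝ)).symm x j ∈ s]
  simp only [Set.mem_Icc, abs_le]
  rfl

theorem measurableSet_univ_pi_update_Icc_Ioc (b ε : ℝ) (i : Fin n) :
    MeasurableSet (Set.univ.pi
      (Function.update (fun _ => Set.Icc (-b) b) i (Set.Ioc b (b + ε)))) :=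
  MeasurableSet.univ_pi <| (Function.forall_update_iff _ fun _ (s : Set ℝ) => MeasurableSet s).2
    ⟨measurableSet_Ioc, fun _ _ => measurableSet_Icc⟩

theorem measurableSet_facetPrism (b ε : ℝ) (i : Fin n) : MeasurableSet (facetPrism b ε i) := by
  rw [facetPrism_eq_preimage]
  exact (MeasurableEquiv.measurable _) (measurableSet_univ_pi_update_Icc_Ioc b ε i)

theorem volume_facetPrism {b ε : ℝ} (hb : 0 ≤ b) (hε : 0 ≤ ε) (i : Fin n) :
    volume (facetPrism b ε i) = ENNReal.ofReal (ε * (2 * b) ^ (n - 1)) := by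
  have hfacet : ∀ j ∈ Finset.univ.erase i, volume (Function.update (fun _ => Set.Icc (-b) b) i
      (Set.Ioc b (b + ε)) j) = ENNReal.ofReal (2 * b) := fun j hj => by
    rw [Function.update_of_ne (Finset.ne_of_mem_erase hj), Real.volume_Icc, sub_neg_eq_add,
      two_mul]
  rw [facetPrism_eq_preimage, (EuclideanSpace.volume_preserving_symm_measurableEquiv_toLp
      (Fin n)).measure_preimage (measurableSet_univ_pi_update_Icc_Ioc b ε i).nullMeasurableSet,
    volume_pi_pi, ← Finset.mul_prod_erase _ _ (Finset.mem_univ i), Finset.prod_congr rfl hfacet,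
    Function.update_self, Real.volume_Ioc, Finset.prod_const,
    Finset.card_erase_of_mem (Finset.mem_univ i), Finset.card_univ, Fintype.card_fin,
    add_sub_cancel_left, ENNReal.ofReal_mul hε, ENNReal.ofReal_pow (by positivity)]

theorem pairwise_disjoint_facetPrism (b ε : ℝ) :
    Pairwise (Function.onFun Disjoint (facetPrism (n := n) b ε)) := fun i _ hij =>
  Set.disjoint_left.2 fun x hi hj =>
    ((le_abs_self (x i)).trans (hj.2 i hij)).not_gt hi.1.1

theorem facetPrism_subset_euclideanCube {a b ε : ℝ} (hb : 0 ≤ b) (hba : b + ε ≤ a) (i : Fin n) :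
    facetPrism b ε i ⊆ euclideanCube n a := by
  intro x hx j
  by_cases hj : j = i
  · rw [hj, abs_of_pos (hb.trans_lt hx.1.1)]
    exact hx.1.2.trans hba
  · linarith [hx.2 j hj, hx.1.1.trans_le hx.1.2]

theorem facetPrism_subset_outerShell {b ε : ℝ} (hb : 0 ≤ b) (hε : 0 ≤ ε) (i : Fin n) :
    facetPrism b ε i ⊆ outerShell (euclideanCube n b) ε := by
  intro x hx
  refine ⟨(mem_add_smul_closedBall_iff hε).2
    ⟨x - EuclideanSpace.single i (x i - b), fun j => ?_, ?_⟩, fun hxb => ?_⟩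
  · by_cases hj : j = i
    · subst hj
      simp [abs_of_nonneg hb]
    · simpa [hj] using hx.2 j hj
  · rw [dist_self_sub_right, PiLp.norm_single, Real.norm_of_nonneg (sub_nonneg.2 hx.1.1.le)]
    linarith [hx.1.2]
  · exact ((le_abs_self (x i)).trans (hxb i)).not_gt hx.1.1

theorem le_uniformCube_outerShell {a b ε : ℝ} (hb : 0 ≤ b) (hε : 0 < ε) (hba : b + ε ≤ a) :
    ENNReal.ofReal (n * (2 * b) ^ (n - 1) / (2 * a) ^ n) * ENNReal.ofReal ε ≤
      uniformCube n a (outerShell (euclideanCube n b) ε) := by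
  have ha : 0 < a := by linarith
  have hunion : ENNReal.ofReal (n * (ε * (2 * b) ^ (n - 1))) ≤
      volume (outerShell (euclideanCube n b) ε ∩ euclideanCube n a) := by
    calc ENNReal.ofReal (n * (ε * (2 * b) ^ (n - 1)))
        = volume (⋃ i : Fin n, facetPrism b ε i) := by
          rw [measure_iUnion (pairwise_disjoint_facetPrism b ε) (measurableSet_facetPrism b ε),
            tsum_fintype]
          simp only [volume_facetPrism hb hε.le, Finset.sum_const, Finset.card_univ,
            Fintype.card_fin, nsmul_eq_mul]
          rw [ENNReal.ofReal_mul (by positivity), ENNReal.ofReal_natCast]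
      _ ≤ _ := measure_mono <| Set.iUnion_subset fun i => Set.subset_inter
          (facetPrism_subset_outerShell hb hε.le i) (facetPrism_subset_euclideanCube hb hba i)
  rw [uniformCube, Measure.smul_apply, Measure.restrict_apply' (measurableSet_euclideanCube n a),
    smul_eq_mul, volume_euclideanCube, ← ENNReal.ofReal_pow (by positivity),
    ← ENNReal.ofReal_inv_of_pos (by positivity), ← ENNReal.ofReal_mul (by positivity)]
  refine le_trans (le_of_eq ?_) (mul_le_mul_right hunion _)
  rw [← ENNReal.ofReal_mul (by positivity)]
  congr 1
  ring

theorem le_maxPerimeter_uniformCube_of_lt {a b : ℝ} (hb : 0 ≤ b) (hba : b < a) :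
    ENNReal.ofReal (n * (2 * b) ^ (n - 1) / (2 * a) ^ n) ≤ maxPerimeter (uniformCube n a) := by
  refine le_trans ?_ (le_iSup₂ (f := fun Q (_ : Convex ℝ Q) => perimeter (uniformCube n a) Q)
    (euclideanCube n b) (convex_euclideanCube n b))
  refine le_liminf_of_le (by isBoundedDefault) ?_
  filter_upwards [Ioo_mem_nhdsGT (sub_pos.2 hba)] with ε hε
  rw [ENNReal.le_div_iff_mul_le (.inl (ENNReal.ofReal_pos.2 hε.1).ne')
    (.inl ENNReal.ofReal_ne_top)]
  exact le_uniformCube_outerShell hb hε.1 (by linarith [hε.2])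

theorem le_maxPerimeter_uniformCube (n : ℕ) {a : ℝ} (ha : 0 < a) :
    ENNReal.ofReal (1 / (2 * a) * n) ≤ maxPerimeter (uniformCube n a) := by
  have hlim : Tendsto (fun b : ℝ => ENNReal.ofReal (n * (2 * b) ^ (n - 1) / (2 * a) ^ n)) (𝓝[<] a)
      (𝓝 (ENNReal.ofReal (n * (2 * a) ^ (n - 1) / (2 * a) ^ n))) :=
    (ENNReal.continuous_ofReal.comp (by fun_prop)).continuousWithinAt
  have hvalue : n * (2 * a) ^ (n - 1) / (2 * a) ^ n = 1 / (2 * a) * n := by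
    rcases n.eq_zero_or_pos with rfl | hn
    · simp
    · rw [← pow_sub_one_mul hn.ne' (2 * a)]
      field_simp
  rw [← hvalue]
  refine le_of_tendsto hlim ?_
  filter_upwards [Ioo_mem_nhdsLT ha] with b hb
  exact le_maxPerimeter_uniformCube_of_lt hb.1.le hb.2

end UniformCube

theorem mainTheorem10 :
    (∃ C₁ C₂ C : ℝ, 0 < C₁ ∧ 0 < C₂ ∧ 0 < C ∧
      ∀ n : ℕ, 1 ≤ n → ∀ μ : Measure (EuclideanSpace ℝ (Fin n)),
        IsLogConcaveMeasure μ → IsIsotropicMeasure μ →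
        (IsUniformOnConvex μ ∨ HasHomogeneousLevelSets μ ∨ IsOneSymmetric μ) →
        (∃ f : EuclideanSpace ℝ (Fin n) → ℝ, IsLogConcaveDensity f μ) ∧
        (∀ f : EuclideanSpace ℝ (Fin n) → ℝ, IsLogConcaveDensity f μ →
          ∃ t : ℝ, 0 < t ∧
            volume (levelSet f t) ≤ ENNReal.ofReal C₁ / eLpNorm f ∞ volume ∧
            ∃ y : EuclideanSpace ℝ (Fin n), Metric.closedBall y C₂ ⊆ levelSet f t) ∧
        maxPerimeter μ ≤ ENNReal.ofReal (C * n)) ∧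
    (∀ n : ℕ, 1 ≤ n → ∀ μ : Measure (EuclideanSpace ℝ (Fin n)),
      HasExpNormDensity μ → HasHomogeneousLevelSets μ) ∧
    (∃ c : ℝ, 0 < c ∧ ∀ n : ℕ, 1 ≤ n → ∃ μ : Measure (EuclideanSpace ℝ (Fin n)),
      IsLogConcaveMeasure μ ∧ IsIsotropicMeasure μ ∧
      IsUniformOnConvex μ ∧ HasHomogeneousLevelSets μ ∧ IsOneSymmetric μ ∧
      ENNReal.ofReal (c * n) ≤ maxPerimeter μ) := by
  refine ⟨⟨2, levelSetInradius, (1 + 2) / levelSetInradius, two_pos, levelSetInradius_pos,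
    div_pos (by norm_num) levelSetInradius_pos, fun n hn μ hlc hμ hclass => ?_⟩,
    fun n _ μ h => h.hasHomogeneousLevelSets, 1 / (2 * √3), by positivity, fun n _ => ?_⟩
  · have := hμ.isProbabilityMeasure
    have hball (f) (hf : IsLogConcaveDensity f μ) :=
      hμ.exists_closedBall_subset_levelSet (Nat.one_le_iff_ne_zero.1 hn) hlc hclass hf
    have hf := hμ.isLogConcaveDensity_lowerDensity hlc
    obtain ⟨t, ht, hvol, y, hy⟩ := hball _ hf
    exact ⟨⟨_, hf⟩, hball,
      hf.maxPerimeter_le_of_volume_levelSet_le ht levelSetInradius_pos zero_le_two hvol hy⟩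
  · have hunif := isUniformOnConvex_uniformCube n (a := √3) (by positivity)
    exact ⟨uniformCube n √3, isLogConcaveMeasure_uniformCube n √3,
      isIsotropicMeasure_uniformCube n, hunif, hunif.hasHomogeneousLevelSets,
      isOneSymmetric_uniformCube n √3, le_maxPerimeter_uniformCube n (by positivity)⟩
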